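/- Let $G$ be a compact (Hausdorff) group with dual object $\widehat G$ (the irreducible unitary representations $\pi$ up to equivalence, $d_\pi$ the dimension) and normalised Haar measure. A weight is a function $\omega:\widehat G\to(0,\infty)$ with $\omega(\sigma)\le\omega(\pi)\omega(\pi')$ whenever $\sigma\subset\pi\otimes\pi'$; it is bounded if $\inf_\pi\omega(\pi)>0$. For a formal series $u\sim\sum_\pi d_\pi\mathrm{Tr}(\hat u(\pi)\pi(\cdot))$ put $$\|u\|_{A_\omega}=\sum_\pi\|\hat u(\pi)\|_1d_\pi\omega(\pi),\qquad \|u\|_{2,\omega}^2=\sum_\pi\|\hat u(\pi)\|_2^2d_\pi\omega(\pi)$$ (trace norm and Hilbert-Schmidt norm), and let $A_\omega(G)$ and $L^2_\omega(G)$ be the spaces of series for which these are finite. For bounded $\omega$ they are a space of continuous functions on $G$ and a Hilbert space contained in $L^2(G)$, respectively. For closed $E\subset G$ let $I_\omega(E)$ be the set of $u\in A_\omega(G)$ vanishing on $E$ and $J_\omega(E)$ the closure in $A_\omega(G)$ of the set of $u\in A_\omega(G)$ vanishing on a neighbourhood of $E$. We say that $E$ is a set of spectral synthesis for $A_\omega(G)$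 if $J_\omega(E)=I_\omega(E)$. The support of a bounded operator $S$ on $L^2_\omega(G)$ is the set of all $(s,t)\in G\times G$ such that for all neighbourhoods $U$ of $s$ and $V$ of $t$ there are $f,g\in L^2_\omega(G)$ with $\mathrm{supp} f\subset V$, $\mathrm{supp} g\subset U$ and $(Sf,g)\neq0$. A set $K\subset G\times G$ is a set of operator synthesis with respect to $\omega$ if $\sum_i(Sf_i,g_i)=0$ for every bounded operator $S$ on $L^2_\omega(G)$ with support contained in $K$ and all sequences $f_i,g_i\in L^2_\omega(G)$ such that $\sum_i\|f_i\|_{2,\omega}\|g_i\|_{2,\omega}<\infty$ and $F(s,t)=\sum_if_i(t)\overline{g_i(s)}$ vanishes on $K$ outside some set $(M\times G)\cup(G\times N)$ with $M,N$ of Haar measure $0$. (If $\omega$ is symmetric, i.e. $\omega(\bar\pi)=\omega(\pi)$, these $F$ are exactly the elements of $L^2_\omega(G)\hat\otimes L^2_\omega(G)$.) (i) Let $\omega$ be a bounded weight on $\widehat G$ and let $E\subset G$ be closed. If $E^*=\{(s,t)\in G\times G: st^{-1}\in E\}$ is a set of operator synthesis with respect to $\omega$, then $E$ is a set of spectral synthesis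 for $A_\omega(G)$. (ii) Let $G$ be a compact Lie group of positive dimension and let $S\subset\widehat G$ be a finite set that generates $\widehat G$, i.e. every $\pi\in\widehat G$ is contained in a tensor product of finitely many elements of $S$. Let $\tau_S(\pi)$ be the least number $k$ of factors in such a product ($k=0$ for the trivial representation), and let $\omega_S=1+\tau_S$. If $\omega$ is a weight on $\widehat G$ with $\omega\ge C\omega_S^\alpha$ for some $C>0$ and $\alpha\ge1$, then the diagonal $D=\{(x,x):x\in G\}$ is not a set of operator synthesis with respect to $\omega$. -/

import Mathlib

open MeasureTheory Topology
open scoped Matrix Kronecker ENNReal Manifold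

namespace BeurlingFourier

universe u

section Dual

variable (G : Type u) [Group G] [TopologicalSpace G]

/-- A continuous irreducible unitary representation of `G` on `ℂ ^ dim`. When `G` is compact, every
continuous irreducible unitary representation on a Hilbert space is finite dimensional, hence
unitarily equivalent to one of these. -/
structure UnitaryIrrep where
  dim : ℕ
  dim_pos : 0 < dim
  toHom : G →* Matrix.unitaryGroup (Fin dim) ℂ
  continuous_toHom : Continuous fun s => (toHom s : Matrix (Fin dim) (Fin dim) ℂ)
  irreducible : ∀ W : Submodule ℂ (Fin dim → ℂ),
    (∀ s, ∀ v ∈ W, (toHom s : Matrix (Fin dim) (Fin dim) ℂ) *ᵥ v ∈ W) → W = ⊥ ∨ W = ⊤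

variable {G}

/-- The matrix `π(s)`. -/
def UnitaryIrrep.mat (π : UnitaryIrrep G) (s : G) : Matrix (Fin π.dim) (Fin π.dim) ℂ :=
  (π.toHom s : Matrix (Fin π.dim) (Fin π.dim) ℂ)

/-- Unitary equivalence of irreducible representations. -/
def UnitaryIrrep.Equivalent (π σ : UnitaryIrrep G) : Prop :=
  ∃ U : Matrix (Fin π.dim) (Fin σ.dim) ℂ,
    U * Uᴴ = 1 ∧ Uᴴ * U = 1 ∧ ∀ s, π.mat s * U = U * σ.mat s

variable (G)

instance UnitaryIrrep.setoid : Setoid (UnitaryIrrep G) where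
  r := UnitaryIrrep.Equivalent
  iseqv :=
    { refl := fun π => ⟨1, by simp, by simp, by simp⟩
      symm := by
        rintro π σ ⟨U, h1, h2, h3⟩
        refine ⟨Uᴴ, by simpa using h2, by simpa using h1, fun s => ?_⟩
        calc σ.mat s * Uᴴ = (Uᴴ * U) * σ.mat s * Uᴴ := by rw [h2, one_mul]
          _ = Uᴴ * (U * σ.mat s) * Uᴴ := by simp only [Matrix.mul_assoc]
          _ = Uᴴ * π.mat s * (U * Uᴴ) := by rw [← h3 s]; simp only [Matrix.mul_assoc]
          _ = Uᴴ * π.mat s := by rw [h1, Matrix.mul_one]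
      trans := by
        rintro π σ τ ⟨U, h1, h2, h3⟩ ⟨V, k1, k2, k3⟩
        refine ⟨U * V, ?_, ?_, fun s => ?_⟩
        · calc U * V * (U * V)ᴴ = U * (V * Vᴴ) * Uᴴ := by
                rw [Matrix.conjTranspose_mul]; simp only [Matrix.mul_assoc]
            _ = 1 := by rw [k1, Matrix.mul_one, h1]
        · calc (U * V)ᴴ * (U * V) = Vᴴ * (Uᴴ * U) * V := by
                rw [Matrix.conjTranspose_mul]; simp only [Matrix.mul_assoc]
            _ = 1 := by rw [h2, Matrix.mul_one, k2]
        · rw [← Matrix.mul_assoc, h3 s, Matrix.mul_assoc, k3 s, Matrix.mul_assoc] }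

/-- The dual object of `G`: irreducible unitary representations up to unitary equivalence. -/
def Dual : Type u := Quotient (UnitaryIrrep.setoid G)

variable {G}

/-- A chosen representation in the class `π`. -/
noncomputable def Dual.rep (π : Dual G) : UnitaryIrrep G := Quotient.out π

/-- The dimension `d_π`. -/
noncomputable def Dual.dim (π : Dual G) : ℕ := π.rep.dim

/-- The matrix `π(s)` of the chosen representation. -/
noncomputable def Dual.mat (π : Dual G) (s : G) : Matrix (Fin π.dim) (Fin π.dim) ℂ := π.rep.mat s

/-- `σ ⊂ ρ`: the irreducible representation `σ` is unitarily equivalent to a subrepresentation of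
the matrix representation `ρ`; `V` is an isometric intertwiner. -/
def Dual.IsSubrep {ι : Type*} [Fintype ι] (σ : Dual G) (ρ : G → Matrix ι ι ℂ) : Prop :=
  ∃ V : Matrix ι (Fin σ.dim) ℂ, Vᴴ * V = 1 ∧ ∀ s, ρ s * V = V * σ.mat s

/-- The representation `σ₁ ⊗ ⋯ ⊗ σₖ` on `ℂ ^ d₁ ⊗ ⋯ ⊗ ℂ ^ dₖ`, in the basis of elementary tensors
of basis vectors. For `k = 0` it is the trivial representation. -/
noncomputable def tensorMat {k : ℕ} (σ : Fin k → Dual G) (s : G) :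
    Matrix (∀ i, Fin (σ i).dim) (∀ i, Fin (σ i).dim) ℂ :=
  fun a b => ∏ i, (σ i).mat s (a i) (b i)

/-- The set `S^{⊗ k}` of those `π` contained in some `σ₁ ⊗ ⋯ ⊗ σₖ` with all `σᵢ ∈ S`. -/
def tensorPower (S : Set (Dual G)) (k : ℕ) : Set (Dual G) :=
  {π | ∃ σ : Fin k → Dual G, (∀ i, σ i ∈ S) ∧ π.IsSubrep (tensorMat σ)}

/-- `S` generates the dual object. -/
def Generates (S : Set (Dual G)) : Prop := ∀ π : Dual G, ∃ k, π ∈ tensorPower S k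

/-- `τ_S(π)`: the least `k` with `π ∈ S^{⊗ k}` (meaningful for generating `S`). -/
noncomputable def wordLength (S : Set (Dual G)) (π : Dual G) : ℕ :=
  sInf {k | π ∈ tensorPower S k}

variable (G)

/-- A weight on the dual object: a positive function with `ω(σ) ≤ ω(π) ω(π')` whenever
`σ ⊂ π ⊗ π'`. -/
structure Weight where
  toFun : Dual G → ℝ
  pos : ∀ π, 0 < toFun π
  submul : ∀ σ π π' : Dual G, σ.IsSubrep (fun s => π.mat s ⊗ₖ π'.mat s) →
    toFun σ ≤ toFun π * toFun π'

variable {G}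

instance : CoeFun (Weight G) (fun _ => Dual G → ℝ) := ⟨Weight.toFun⟩

/-- A weight is bounded if it is bounded away from `0`. -/
def Weight.IsBounded (ω : Weight G) : Prop := ∃ c > 0, ∀ π, c ≤ ω π

variable (G)

/-- Formal trigonometric series, given by their Fourier coefficients `û(π)`. -/
abbrev Series : Type u := ∀ π : Dual G, Matrix (Fin π.dim) (Fin π.dim) ℂ

end Dual

section Algebra

variable {G : Type u} [Group G] [TopologicalSpace G]

/-- The trace norm `‖A‖₁`: the sum of the singular values. -/
noncomputable def traceNorm {d : ℕ} (A : Matrix (Fin d) (Fin d) ℂ) : ℝ :=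
  ∑ i : Fin d, (Matrix.toEuclideanLin A).singularValues i

/-- The norm `∑ ‖û(π)‖₁ d_π ω(π)`, with values in `[0, ∞]`. -/
noncomputable def AOmegaNorm (ω : Weight G) (u : Series G) : ℝ≥0∞ :=
  ∑' π, ENNReal.ofReal (traceNorm (u π) * π.dim * ω π)

/-- The Beurling-Fourier algebra `A_ω(G)`. -/
def AOmega (ω : Weight G) : Set (Series G) := {u | AOmegaNorm ω u < ∞}

/-- The function `u(s) = ∑ d_π Tr(û(π) π(s))` on `G`; for bounded `ω` and `u ∈ A_ω(G)` the series
converges absolutely and uniformly. -/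
noncomputable def evalSeries (u : Series G) (s : G) : ℂ :=
  ∑' π : Dual G, (π.dim : ℂ) * (u π * π.mat s).trace

/-- `I_ω(E)`: the elements of `A_ω(G)` vanishing on `E`. -/
def idealI (ω : Weight G) (E : Set G) : Set (Series G) :=
  {u ∈ AOmega ω | ∀ s ∈ E, evalSeries u s = 0}

/-- `J⁰_ω(E)`: the elements of `A_ω(G)` vanishing on a neighbourhood of `E`. -/
def idealJ0 (ω : Weight G) (E : Set G) : Set (Series G) :=
  {u ∈ AOmega ω | ∃ U ∈ 𝓝ˢ E, ∀ s ∈ U, evalSeries u s = 0}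

/-- `J_ω(E)`: the closure of `J⁰_ω(E)` in `A_ω(G)`. -/
def idealJ (ω : Weight G) (E : Set G) : Set (Series G) :=
  {u ∈ AOmega ω | ∀ ε : ℝ≥0∞, 0 < ε → ∃ v ∈ idealJ0 ω E, AOmegaNorm ω (u - v) < ε}

/-- `E` is a set of spectral synthesis for `A_ω(G)`. -/
def IsSpectralSynthesis (ω : Weight G) (E : Set G) : Prop := idealJ ω E = idealI ω E

end Algebra

section Hilbert

variable {G : Type u} [Group G] [TopologicalSpace G]

/-- The matrices on `ℂ ^ d_π` with the inner product `(A, B) = d_π ω(π) Tr(A Bᴴ)`, i.e. the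
Hilbert-Schmidt norm scaled by `(d_π ω(π)) ^ (1/2)`. -/
def HSFiber (_ω : Weight G) (π : Dual G) : Type := Matrix (Fin π.dim) (Fin π.dim) ℂ

/-- The underlying matrix. -/
def HSFiber.toMatrix {ω : Weight G} {π : Dual G} (A : HSFiber ω π) :
    Matrix (Fin π.dim) (Fin π.dim) ℂ := A

/-- The scalar matrix `d_π ω(π) 1`. -/
noncomputable def scaleMat (ω : Weight G) (π : Dual G) : Matrix (Fin π.dim) (Fin π.dim) ℂ :=
  (((π.dim : ℝ) * ω π : ℝ) : ℂ) • 1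

section

open scoped ComplexOrder

theorem scaleMat_posDef (ω : Weight G) (π : Dual G) : (scaleMat ω π).PosDef := by
  have h : (0 : ℝ) < (π.dim : ℝ) * ω π :=
    mul_pos (by exact_mod_cast π.rep.dim_pos) (ω.pos π)
  exact Matrix.PosDef.one.smul (Complex.zero_lt_real.mpr h)

noncomputable instance (ω : Weight G) (π : Dual G) : NormedAddCommGroup (HSFiber ω π) :=
  Matrix.toMatrixNormedAddCommGroup (scaleMat ω π) (scaleMat_posDef ω π)

noncomputable instance (ω : Weight G) (π : Dual G) : InnerProductSpace ℂ (HSFiber ω π) :=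
  Matrix.toMatrixInnerProductSpace (scaleMat ω π) (scaleMat_posDef ω π).posSemidef

end

/-- The Hilbert space `L²_ω(G)` of formal series `ξ` with `∑ ‖ξ̂(π)‖₂² d_π ω(π) < ∞`; its elements
are literally the families `π ↦ ξ̂(π)`. -/
abbrev L2Omega (ω : Weight G) : Type u := lp (fun π : Dual G => HSFiber ω π) 2

/-- The Fourier coefficient `ξ̂(π)`. -/
def coeff {ω : Weight G} (ξ : L2Omega ω) (π : Dual G) : Matrix (Fin π.dim) (Fin π.dim) ℂ :=
  (ξ π).toMatrix

/-- The scalar product `(ξ, η)` of `L²_ω(G)`, linear in the first variable. It is Mathlib's inner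
product with the variables exchanged; the instance is named because Lean would otherwise go through
C⋆-modules. -/
noncomputable def scalarProd {ω : Weight G} (ξ η : L2Omega ω) : ℂ :=
  @inner ℂ (L2Omega ω) InnerProductSpace.toInner η ξ

theorem HSFiber.inner_eq {ω : Weight G} {π : Dual G} (A B : HSFiber ω π) :
    @inner ℂ (HSFiber ω π) InnerProductSpace.toInner A B
      = (((π.dim : ℝ) * ω π : ℝ) : ℂ) * (B.toMatrix * A.toMatrixᴴ).trace := by
  change (B.toMatrix * scaleMat ω π * A.toMatrixᴴ).trace = _
  simp [scaleMat]

/-- `(ξ, η) = ∑ d_π ω(π) Tr(ξ̂(π) η̂(π)ᴴ)`. -/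
theorem scalarProd_eq {ω : Weight G} (ξ η : L2Omega ω) :
    scalarProd ξ η
      = ∑' π : Dual G, (((π.dim : ℝ) * ω π : ℝ) : ℂ) * (coeff ξ π * (coeff η π)ᴴ).trace :=
  (lp.inner_eq_tsum η ξ).trans (tsum_congr fun π => HSFiber.inner_eq (η π) (ξ π))

variable [IsTopologicalGroup G] [CompactSpace G] [MeasurableSpace G] [BorelSpace G]

/-- Haar measure on the compact group `G`, normalised to total mass `1`. -/
noncomputable def haarProb (G : Type u) [Group G] [TopologicalSpace G] [IsTopologicalGroup G]
    [CompactSpace G] [MeasurableSpace G] [BorelSpace G] : Measure G :=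
  Measure.haarMeasure (⊤ : TopologicalSpace.PositiveCompacts G)

noncomputable instance : IsFiniteMeasure (haarProb G) := by
  unfold haarProb; infer_instance

/-- The continuous function `s ↦ d_π Tr(A π(s))`. -/
noncomputable def trigFun (π : Dual G) (A : Matrix (Fin π.dim) (Fin π.dim) ℂ) : C(G, ℂ) where
  toFun s := (π.dim : ℂ) * (A * π.mat s).trace
  continuous_toFun := by
    have h : Continuous fun s => π.mat s := π.rep.continuous_toHom
    exact continuous_const.mul (continuous_const.matrix_mul h).matrix_trace

/-- The element `∑ d_π Tr(ξ̂(π) π(·))` of `L²(G)` given by `ξ ∈ L²_ω(G)`; the terms are orthogonal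
and for bounded `ω` the series converges in `L²(G)`. -/
noncomputable def toL2 {ω : Weight G} (ξ : L2Omega ω) : Lp ℂ 2 (haarProb G) :=
  ∑' π : Dual G, ContinuousMap.toLp 2 (haarProb G) ℂ (trigFun π (coeff ξ π))

/-- The closed support of a function defined almost everywhere. -/
def essSupport (f : G → ℂ) : Set G :=
  {x | ∀ U ∈ 𝓝 x, ¬ ∀ᵐ y ∂(haarProb G), y ∈ U → f y = 0}

/-- The support of a bounded operator `S` on `L²_ω(G)`. -/
def opSupport {ω : Weight G} (S : L2Omega ω →L[ℂ] L2Omega ω) : Set (G × G) :=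
  {p | ∀ U ∈ 𝓝 p.1, ∀ V ∈ 𝓝 p.2, ∃ f g : L2Omega ω,
    essSupport (toL2 f) ⊆ V ∧ essSupport (toL2 g) ⊆ U ∧ scalarProd (S f) g ≠ 0}

/-- Marginally null subsets of `G × G`. -/
def IsMarginallyNull (Z : Set (G × G)) : Prop :=
  ∃ M N : Set G, haarProb G M = 0 ∧ haarProb G N = 0 ∧
    Z ⊆ M ×ˢ Set.univ ∪ Set.univ ×ˢ N

/-- `F(s, t) = ∑ fᵢ(t) conj(gᵢ(s))` vanishes marginally almost everywhere on `K`. -/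
def VanishesMAEOn {ω : Weight G} (f g : ℕ → L2Omega ω) (K : Set (G × G)) : Prop :=
  IsMarginallyNull
    {p ∈ K | ¬ HasSum (fun i => toL2 (f i) p.2 * starRingEnd ℂ (toL2 (g i) p.1)) 0}

/-- `K ⊆ G × G` is a set of operator synthesis with respect to `ω`: `⟨S, F⟩ = 0` for every bounded
operator `S` on `L²_ω(G)` supported in `K` and every `F` in the projective tensor product vanishing
marginally almost everywhere on `K`. Here `F = ∑ fᵢ ⊗ conj gᵢ` with `fᵢ, gᵢ ∈ L²_ω(G)` and
`∑ ‖fᵢ‖ ‖gᵢ‖ < ∞`, i.e. `F(s, t) = ∑ fᵢ(t) conj(gᵢ(s))`, and `⟨S, F⟩ = ∑ (S fᵢ, gᵢ)`. For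
symmetric `ω` complex conjugation is an isometry of `L²_ω(G)`, so these are exactly the elements
of the projective tensor square of `L²_ω(G)` with the pairing `⟨S, f ⊗ g⟩ = (S f, conj g)`. -/
def IsOperatorSynthesis (ω : Weight G) (K : Set (G × G)) : Prop :=
  ∀ (S : L2Omega ω →L[ℂ] L2Omega ω) (f g : ℕ → L2Omega ω),
    opSupport S ⊆ K → Summable (fun i => ‖f i‖ * ‖g i‖) → VanishesMAEOn f g K →
      ∑' i, scalarProd (S (f i)) (g i) = 0

end Hilbert

/-- The set `E* = {(s, t) : s t⁻¹ ∈ E}`. -/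
def starSet {G : Type u} [Group G] (E : Set G) : Set (G × G) := {p | p.1 * p.2⁻¹ ∈ E}

end BeurlingFourier

open BeurlingFourier

/-! Both parts are duality arguments. The link between `A_ω` and `L²_ω` is the map `(f, g) ↦ conv f
g`, whose Fourier coefficients are `f̂(π)ᴴ ĝ(π)` and whose value at `x` is `∫ conj (f(t)) g(xt) dt`.
By Cauchy-Schwarz it is bounded by `‖f‖ ‖g‖`, so a functional `T` on `A_ω` defines an operator `S`
with `(S f, g) = conj (T (conv f g))`.

(i) If `u ∈ I_ω(E)` is not in `J_ω(E)`, Hahn-Banach gives `T` with `T u ≠ 0` that annihilates all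
functions vanishing near `E`. Since `conv f g` vanishes off the compact set `supp g · (supp f)⁻¹`,
the operator `S` is supported in `E*` (`opSupport_subset_starSet`). The singular value decomposition
of each `û(π)` writes `u` as an absolutely convergent sum of `conv fᵢ gᵢ` with `∑ fᵢ(t) conj (gᵢ(s))
= conj (u(s t⁻¹))` (`exists_sequences_of_beurlingSpace`). This kernel vanishes on `E*`, so operator
synthesis gives `conj (T u) = ∑ (S fᵢ, gᵢ) = 0`, a contradiction.

(ii) The diagonal is `{1}*`, so by (i) it suffices that `{1}` is not a set of spectral synthesis.
Put `ε(g) = ∑_{σ ∈ S} ‖σ(g) - 1‖`. Telescoping tensor products gives `‖π(g) - 1‖ ≤ τ_S(π) ε(g) ≤ C⁻¹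
ω(π) ε(g)`, hence `|w(g) - w(1)| ≤ C⁻¹ ε(g) ‖w‖` for all `w ∈ A_ω`. If synthesis held, each entry `u
= σ_ij - δ_ij` would be within any `η > 0` of some `v` vanishing near `1`; with `w = u - v` this
gives `|u(g)| ≤ C⁻¹ η ε(g)` near `1`. For small `η`, summing over the entries of all `σ ∈ S` forces
`ε(g) = 0`. Then `π(g) = 1` for all `π`, so `g = 1` by the Peter-Weyl theorem, and `1` would be
isolated, which is impossible in positive dimension. -/

namespace BeurlingFourier

universe u

/-! ### Trace norm: singular values and duality with the operator norm -/

section TraceNorm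

open scoped Matrix.Norms.L2Operator ComplexConjugate

variable {d : ℕ}

theorem trace_vecMulVec_star_mul (x y : EuclideanSpace ℂ (Fin d)) (B : Matrix (Fin d) (Fin d) ℂ) :
    (Matrix.vecMulVec x.ofLp (star y.ofLp) * B).trace
      = inner ℂ y (Matrix.toEuclideanLin B x) := by
  rw [Matrix.vecMulVec_eq Unit, Matrix.mul_assoc, Matrix.trace_mul_comm, Matrix.mul_assoc]
  simp [EuclideanSpace.inner_eq_star_dotProduct, Matrix.trace, Matrix.mul_apply, dotProduct,
    Matrix.mulVec, Matrix.toLpLin_apply, mul_comm]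

theorem norm_toEuclideanLin_le (B : Matrix (Fin d) (Fin d) ℂ) (x : EuclideanSpace ℂ (Fin d)) :
    ‖Matrix.toEuclideanLin B x‖ ≤ ‖B‖ * ‖x‖ :=
  Matrix.l2_opNorm_mulVec B x

theorem norm_trace_vecMulVec_star_mul_le (x y : EuclideanSpace ℂ (Fin d))
    (B : Matrix (Fin d) (Fin d) ℂ) :
    ‖(Matrix.vecMulVec x.ofLp (star y.ofLp) * B).trace‖ ≤ ‖x‖ * ‖y‖ * ‖B‖ := by
  rw [trace_vecMulVec_star_mul]
  calc _ ≤ ‖y‖ * ‖Matrix.toEuclideanLin B x‖ := norm_inner_le_norm _ _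
    _ ≤ ‖y‖ * (‖B‖ * ‖x‖) := by gcongr; exact norm_toEuclideanLin_le B x
    _ = _ := by ring

/-- The singular value decomposition. -/
theorem exists_singularValue_decomposition (A : Matrix (Fin d) (Fin d) ℂ) :
    ∃ x y : Fin d → EuclideanSpace ℂ (Fin d), Orthonormal ℂ y ∧
      (∀ i j, i ≠ j → inner ℂ (x i) (x j) = 0) ∧
      A = ∑ j, Matrix.vecMulVec (x j).ofLp (star (y j).ofLp) ∧ traceNorm A = ∑ j, ‖x j‖ := by
  set T := Matrix.toEuclideanLin A with hT
  have hn : Module.finrank ℂ (EuclideanSpace ℂ (Fin d)) = d := by simp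
  -- The right singular vectors diagonalise `T* T`; their images under `T` are therefore orthogonal,
  -- with the singular values as lengths.
  set b := T.isSymmetric_adjoint_comp_self.eigenvectorBasis hn with hb
  have key : ∀ i j, inner ℂ (T (b i)) (T (b j))
      = (T.isSymmetric_adjoint_comp_self.eigenvalues hn j : ℂ) * inner ℂ (b i) (b j) := by
    intro i j
    rw [← LinearMap.adjoint_inner_right]
    have h := T.isSymmetric_adjoint_comp_self.apply_eigenvectorBasis hn j
    rw [LinearMap.comp_apply] at h
    rw [hb, h, inner_smul_right]; rfl
  refine ⟨fun j => T (b j), b, b.orthonormal, fun i j hij => ?_, ?_, ?_⟩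
  · rw [key, b.orthonormal.2 hij, mul_zero]
  · apply Matrix.toEuclideanLin.injective
    refine LinearMap.ext fun v => ?_
    rw [← hT, map_sum, LinearMap.sum_apply]
    conv_lhs => rw [← b.sum_repr v, map_sum]
    refine Finset.sum_congr rfl fun j _ => ?_
    rw [map_smul, OrthonormalBasis.repr_apply_apply]
    ext i
    simp [Matrix.vecMulVec_mulVec, EuclideanSpace.inner_eq_star_dotProduct, Matrix.toLpLin_apply,
      dotProduct_comm, mul_comm]
  · refine Finset.sum_congr rfl fun j _ => ?_
    rw [T.singularValues_fin hn j]
    rw [Real.sqrt_eq_iff_mul_self_eq (T.isPositive_adjoint_comp_self.nonneg_eigenvalues hn j)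
      (norm_nonneg _)]
    have h := key j j
    rw [inner_self_eq_norm_sq_to_K, inner_self_eq_norm_sq_to_K, b.orthonormal.1 j] at h
    have h' : ((‖T (b j)‖ ^ 2 : ℝ) : ℂ)
      = (T.isSymmetric_adjoint_comp_self.eigenvalues hn j : ℂ) := by simpa using h
    rw [← sq]; exact (Complex.ofReal_injective h').symm

theorem traceNorm_nonneg (A : Matrix (Fin d) (Fin d) ℂ) : 0 ≤ traceNorm A :=
  Finset.sum_nonneg fun i _ => LinearMap.singularValues_nonneg _ i

theorem norm_trace_mul_le (A B : Matrix (Fin d) (Fin d) ℂ) :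
    ‖(A * B).trace‖ ≤ traceNorm A * ‖B‖ := by
  obtain ⟨x, y, hy, -, hA, hn⟩ := exists_singularValue_decomposition A
  rw [hn]
  conv_lhs => rw [hA]
  rw [Finset.sum_mul, Matrix.trace_sum, Finset.sum_mul]
  refine norm_sum_le_of_le _ fun j _ => ?_
  simpa [hy.1 j] using norm_trace_vecMulVec_star_mul_le (x j) (y j) B

/-- The supremum in the duality is attained at the adjoint of the partial isometry in the polar
decomposition of `A`. -/
theorem exists_trace_mul_eq_traceNorm (A : Matrix (Fin d) (Fin d) ℂ) :
    ∃ B : Matrix (Fin d) (Fin d) ℂ, ‖B‖ ≤ 1 ∧ (A * B).trace = traceNorm A := by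
  obtain ⟨x, y, hy, hx, hA, hn⟩ := exists_singularValue_decomposition A
  -- For `x j = 0` the convention `0⁻¹ = 0` makes `z j = 0`, so the nonzero `z j` are orthonormal
  -- and Bessel's inequality bounds `‖B‖`.
  set z : Fin d → EuclideanSpace ℂ (Fin d) := fun j => ((‖x j‖⁻¹ : ℝ) : ℂ) • x j with hz
  set B : Matrix (Fin d) (Fin d) ℂ := ∑ j, Matrix.vecMulVec (y j).ofLp (star (z j).ofLp) with hB
  have hBv : ∀ v, Matrix.toEuclideanLin B v = ∑ j, inner ℂ (z j) v • y j := by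
    intro v
    rw [hB, map_sum, LinearMap.sum_apply]
    refine Finset.sum_congr rfl fun j _ => ?_
    ext i
    simp [Matrix.vecMulVec_mulVec, EuclideanSpace.inner_eq_star_dotProduct, Matrix.toLpLin_apply,
      dotProduct_comm, mul_comm]
  have hzo : Orthonormal ℂ fun j : {j // x j ≠ 0} => z j := by
    refine ⟨fun j => ?_, fun i j hij => ?_⟩
    · have : ‖x j‖ ≠ 0 := norm_ne_zero_iff.2 j.2
      simp [hz, norm_smul, this]
    · simp [hz, inner_smul_left, inner_smul_right, hx i j (fun h => hij (Subtype.ext h))]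
  refine ⟨B, ?_, ?_⟩
  · rw [Matrix.l2_opNorm_def]
    refine ContinuousLinearMap.opNorm_le_bound _ zero_le_one fun v => ?_
    rw [one_mul]
    change ‖Matrix.toEuclideanLin B v‖ ≤ ‖v‖
    rw [← sq_le_sq₀ (norm_nonneg _) (norm_nonneg _), hBv]
    have h1 : ‖∑ j, inner ℂ (z j) v • y j‖ ^ 2 = ∑ j, ‖inner ℂ (z j) v‖ ^ 2 := by
      rw [← Complex.ofReal_inj]
      have := hy.inner_sum (fun j => inner ℂ (z j) v) (fun j => inner ℂ (z j) v) Finset.univ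
      rw [inner_self_eq_norm_sq_to_K] at this
      simp only [Complex.coe_algebraMap] at this
      push_cast
      erw [this]
      refine Finset.sum_congr rfl fun j _ => ?_
      rw [mul_comm]; exact Complex.mul_conj' _
    have h2 : ∑ j, ‖inner ℂ (z j) v‖ ^ 2 = ∑ j : {j // x j ≠ 0}, ‖inner ℂ (z j) v‖ ^ 2 := by
      rw [← Finset.sum_subtype (Finset.univ.filter fun j => x j ≠ 0) (by simp)
        fun j => ‖inner ℂ (z j) v‖ ^ 2]
      exact (Finset.sum_filter_of_ne (p := fun j => x j ≠ 0)
        fun j _ h hxj => h (by simp [hz, hxj])).symm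
    rw [h1, h2]
    exact hzo.sum_inner_products_le (x := v) (s := Finset.univ)
  · rw [hn]
    conv_lhs => rw [hA]
    rw [Finset.sum_mul, Matrix.trace_sum]
    push_cast
    refine Finset.sum_congr rfl fun j _ => ?_
    rw [trace_vecMulVec_star_mul, hBv, hy.inner_right_fintype]
    by_cases h : x j = 0
    · simp [h]
    · have : (‖x j‖ : ℂ) ≠ 0 := by simpa using h
      simp only [hz, inner_smul_left, inner_self_eq_norm_sq_to_K]
      simp
      field_simp

/-- Through this characterisation the triangle inequality and the Hölder-type bound for the trace
norm become statements about traces. -/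
theorem traceNorm_le_of_forall_norm_trace_le {A : Matrix (Fin d) (Fin d) ℂ} {c : ℝ}
    (h : ∀ B : Matrix (Fin d) (Fin d) ℂ, ‖B‖ ≤ 1 → ‖(A * B).trace‖ ≤ c) : traceNorm A ≤ c := by
  obtain ⟨B, hB, hAB⟩ := exists_trace_mul_eq_traceNorm A
  simpa [hAB, abs_of_nonneg (traceNorm_nonneg A)] using h B hB

theorem traceNorm_add_le (A A' : Matrix (Fin d) (Fin d) ℂ) :
    traceNorm (A + A') ≤ traceNorm A + traceNorm A' := by
  refine traceNorm_le_of_forall_norm_trace_le fun B hB => ?_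
  rw [add_mul, Matrix.trace_add]
  refine norm_add_le_of_le ?_ ?_
  · exact (norm_trace_mul_le A B).trans (mul_le_of_le_one_right (traceNorm_nonneg A) hB)
  · exact (norm_trace_mul_le A' B).trans (mul_le_of_le_one_right (traceNorm_nonneg A') hB)

theorem traceNorm_smul_le (c : ℂ) (A : Matrix (Fin d) (Fin d) ℂ) :
    traceNorm (c • A) ≤ ‖c‖ * traceNorm A := by
  refine traceNorm_le_of_forall_norm_trace_le fun B hB => ?_
  rw [Matrix.smul_mul, Matrix.trace_smul, norm_smul]
  gcongr
  exact (norm_trace_mul_le A B).trans (mul_le_of_le_one_right (traceNorm_nonneg A) hB)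

theorem traceNorm_smul (c : ℂ) (A : Matrix (Fin d) (Fin d) ℂ) :
    traceNorm (c • A) = ‖c‖ * traceNorm A := by
  refine (traceNorm_smul_le c A).antisymm ?_
  rcases eq_or_ne c 0 with hc | hc
  · rw [hc, norm_zero, zero_mul]
    exact traceNorm_nonneg _
  · have h := traceNorm_smul_le c⁻¹ (c • A)
    rw [smul_smul, inv_mul_cancel₀ hc, one_smul, norm_inv] at h
    have hc' : 0 < ‖c‖ := norm_pos_iff.2 hc
    rwa [← div_eq_inv_mul, le_div_iff₀ hc', mul_comm] at h

theorem traceNorm_eq_zero {A : Matrix (Fin d) (Fin d) ℂ} (h : traceNorm A = 0) : A = 0 := by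
  obtain ⟨x, y, -, -, hA, hn⟩ := exists_singularValue_decomposition A
  rw [h] at hn
  have hx : ∀ j, x j = 0 := fun j => norm_eq_zero.1
    ((Finset.sum_eq_zero_iff_of_nonneg fun j _ => norm_nonneg _).1 hn.symm j (Finset.mem_univ j))
  rw [hA]
  exact Finset.sum_eq_zero fun j _ => by simp [hx j]

theorem traceNorm_zero : traceNorm (0 : Matrix (Fin d) (Fin d) ℂ) = 0 := by
  simpa using traceNorm_smul 0 (0 : Matrix (Fin d) (Fin d) ℂ)

/-- `‖Fᴴ G‖₁ ≤ ‖F‖₂ ‖G‖₂`. -/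
theorem traceNorm_conjTranspose_mul_le (F G : Matrix (Fin d) (Fin d) ℂ) :
    traceNorm (Fᴴ * G)
      ≤ Real.sqrt (∑ i, ∑ j, ‖F i j‖ ^ 2) * Real.sqrt (∑ i, ∑ j, ‖G i j‖ ^ 2) := by
  refine traceNorm_le_of_forall_norm_trace_le fun B hB => ?_
  have hFG : Fᴴ * G = ∑ i, Matrix.vecMulVec (WithLp.toLp 2 (star (F i))).ofLp
      (star (WithLp.toLp 2 (star (G i))).ofLp) := by
    ext a b
    simp [Matrix.mul_apply, Matrix.sum_apply, Matrix.vecMulVec_apply]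
  rw [hFG, Finset.sum_mul, Matrix.trace_sum]
  have hnorm : ∀ (M : Matrix (Fin d) (Fin d) ℂ) i,
      ‖(WithLp.toLp 2 (star (M i)) : EuclideanSpace ℂ (Fin d))‖ ^ 2 = ∑ j, ‖M i j‖ ^ 2 := by
    intro M i
    rw [EuclideanSpace.norm_sq_eq]
    simp
  calc _ ≤ ∑ i, ‖(WithLp.toLp 2 (star (F i)) : EuclideanSpace ℂ (Fin d))‖
        * ‖(WithLp.toLp 2 (star (G i)) : EuclideanSpace ℂ (Fin d))‖ := by
        refine norm_sum_le_of_le _ fun i _ => ?_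
        refine (norm_trace_vecMulVec_star_mul_le _ _ B).trans ?_
        exact mul_le_of_le_one_right (by positivity) hB
    _ ≤ _ := by
        refine (Real.sum_mul_le_sqrt_mul_sqrt _ _ _).trans_eq ?_
        simp only [hnorm]

theorem norm_eq_one_of_mem_unitary_of_pos (hd : 0 < d) {U : Matrix (Fin d) (Fin d) ℂ}
    (hU : U ∈ Matrix.unitaryGroup (Fin d) ℂ) : ‖U‖ = 1 := by
  have : Nonempty (Fin d) := ⟨⟨0, hd⟩⟩
  exact CStarRing.norm_of_mem_unitary hU

end TraceNorm

/-! ### Unitary representations on a Hilbert space -/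

section UnitaryRep

variable {G : Type u} [Group G]
  {H : Type*} [NormedAddCommGroup H] [InnerProductSpace ℂ H] (l : G →* (H →ₗᵢ[ℂ] H))

theorem unitaryRep_mul_apply (g h : G) (v : H) : l (g * h) v = l g (l h v) := by
  rw [map_mul]; rfl

theorem unitaryRep_one_apply (v : H) : l 1 v = v := by
  rw [map_one]; rfl

theorem unitaryRep_inner_left (g : G) (u v : H) : inner ℂ (l g u) v = inner ℂ u (l g⁻¹ v) := by
  rw [← (l g⁻¹).inner_map_map (l g u) v, ← unitaryRep_mul_apply, inv_mul_cancel,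
    unitaryRep_one_apply]

end UnitaryRep

/-! ### Peter-Weyl: irreducible representations separate points -/

section PeterWeyl

variable {G : Type u} [Group G] [TopologicalSpace G]

/-- A finite-dimensional unitary representation in matrix form, given by an irreducible invariant
subspace of a unitary representation. -/
theorem exists_unitaryIrrep_of_irreducible {H : Type*} [NormedAddCommGroup H]
    [InnerProductSpace ℂ H] (l : G →* (H →ₗᵢ[ℂ] H)) (hl : ∀ v, Continuous fun g => l g v)
    (W : Submodule ℂ H) [FiniteDimensional ℂ W] (hW : ∀ g, ∀ v ∈ W, l g v ∈ W)
    (hirr : ∀ W' ≤ W, (∀ g, ∀ v ∈ W', l g v ∈ W') → W' = ⊥ ∨ W' = W)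
    (g₀ : G) (hg₀ : ∃ v ∈ W, l g₀ v ≠ v) : ∃ π : UnitaryIrrep G, π.mat g₀ ≠ 1 := by
  set b := stdOrthonormalBasis ℂ W with hb
  set M : G → Matrix (Fin (Module.finrank ℂ W)) (Fin (Module.finrank ℂ W)) ℂ :=
    fun g => Matrix.of fun i j => inner ℂ (b i : H) (l g (b j)) with hM
  have hadj := unitaryRep_inner_left l
  have hexp : ∀ w ∈ W, w = ∑ i, inner ℂ (b i : H) w • (b i : H) := by
    intro w hw
    have := congrArg (Subtype.val) (b.sum_repr' ⟨w, hw⟩).symm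
    simpa using this
  have hmul : ∀ g h, M (g * h) = M g * M h := by
    intro g h
    ext i j
    rw [Matrix.mul_apply]
    simp only [hM, Matrix.of_apply]
    rw [unitaryRep_mul_apply]
    conv_lhs => rw [hexp (l h (b j)) (hW h _ (b j).2), map_sum, inner_sum]
    refine Finset.sum_congr rfl fun k _ => ?_
    rw [map_smul, inner_smul_right, mul_comm]
  have hone : M 1 = 1 := by
    ext i j
    have := (orthonormal_iff_ite.1 b.orthonormal) i j
    simp only [hM, Matrix.of_apply, unitaryRep_one_apply, Matrix.one_apply]
    rwa [Submodule.coe_inner] at this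
  have hstar : ∀ g, star (M g) = M g⁻¹ := by
    intro g
    ext i j
    simp only [hM, Matrix.star_apply, Matrix.of_apply]
    rw [RCLike.star_def, inner_conj_symm, hadj]
  have hunit : ∀ g, M g ∈ Matrix.unitaryGroup (Fin (Module.finrank ℂ W)) ℂ := by
    intro g
    rw [Matrix.mem_unitaryGroup_iff, hstar, ← hmul, mul_inv_cancel, hone]
  -- The coordinate map intertwines `M` with `l` and has range `W`, so invariant subspaces of `ℂⁿ`
  -- correspond to invariant subspaces of `W`.
  let E : (Fin (Module.finrank ℂ W) → ℂ) →ₗ[ℂ] H :=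
    W.subtype ∘ₗ (b.toBasis.equivFun.symm : (Fin (Module.finrank ℂ W) → ℂ) →ₗ[ℂ] W)
  have hE : ∀ c, E c = ∑ i, c i • (b i : H) := by
    intro c
    change ((b.toBasis.equivFun.symm c : W) : H) = _
    rw [Module.Basis.equivFun_symm_apply]
    simp
  have hEinj : Function.Injective E :=
    Subtype.val_injective.comp b.toBasis.equivFun.symm.injective
  have hErange : Submodule.map E ⊤ = W := by
    rw [Submodule.map_top, LinearMap.range_comp, LinearEquiv.range, Submodule.map_top,
      Submodule.range_subtype]
  have hlE : ∀ g c, l g (E c) = E (M g *ᵥ c) := by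
    intro g c
    rw [hE, hE, map_sum]
    have : ∀ j, l g (c j • (b j : H)) = ∑ i, (M g i j * c j) • (b i : H) := by
      intro j
      rw [map_smul]
      conv_lhs => rw [hexp (l g (b j)) (hW g _ (b j).2), Finset.smul_sum]
      refine Finset.sum_congr rfl fun i _ => ?_
      rw [smul_smul, mul_comm]; rfl
    simp only [this]
    rw [Finset.sum_comm]
    refine Finset.sum_congr rfl fun i _ => ?_
    rw [← Finset.sum_smul]; rfl
  obtain ⟨v, hvW, hv⟩ := hg₀
  have hW0 : W ≠ ⊥ := by
    rintro rfl
    rw [Submodule.mem_bot] at hvW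
    exact hv (by rw [hvW, map_zero])
  let π : UnitaryIrrep G :=
    { dim := Module.finrank ℂ W
      dim_pos := Nat.pos_of_ne_zero fun h => hW0 (Submodule.finrank_eq_zero.1 h)
      toHom :=
        { toFun := fun g => ⟨M g, hunit g⟩
          map_one' := Subtype.ext hone
          map_mul' := fun g h => Subtype.ext (hmul g h) }
      continuous_toHom := continuous_matrix fun i j => by
        exact continuous_const.inner (hl (b j))
      irreducible := by
        intro U hU
        have hmap : Submodule.map E U ≤ W := (Submodule.map_mono le_top).trans hErange.le
        have hinv : ∀ g, ∀ v ∈ Submodule.map E U, l g v ∈ Submodule.map E U := by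
          rintro g _ ⟨c, hc, rfl⟩
          exact ⟨M g *ᵥ c, hU g c hc, (hlE g c).symm⟩
        refine (hirr (Submodule.map E U) hmap hinv).imp (fun h => ?_) fun h => ?_
        · exact Submodule.map_injective_of_injective hEinj (h.trans (Submodule.map_bot E).symm)
        · exact Submodule.map_injective_of_injective hEinj (h.trans hErange.symm) }
  refine ⟨π, fun h => hv ?_⟩
  have h' : M g₀ = 1 := h
  have hvE : v ∈ Submodule.map E ⊤ := by rwa [hErange]
  obtain ⟨c, -, rfl⟩ := hvE
  rw [hlE, h', Matrix.one_mulVec]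

/-- A minimal finite-dimensional invariant subspace on which `g₀` acts nontrivially is
irreducible. -/
theorem exists_unitaryIrrep_of_finiteDimensional {H : Type*} [NormedAddCommGroup H]
    [InnerProductSpace ℂ H] (l : G →* (H →ₗᵢ[ℂ] H)) (hl : ∀ v, Continuous fun g => l g v)
    (g₀ : G) (hex : ∃ W : Submodule ℂ H, FiniteDimensional ℂ W ∧ (∀ g, ∀ v ∈ W, l g v ∈ W) ∧
      ∃ v ∈ W, l g₀ v ≠ v) : ∃ π : UnitaryIrrep G, π.mat g₀ ≠ 1 := by
  classical
  have hex' : ∃ n, ∃ W : Submodule ℂ H, FiniteDimensional ℂ W ∧ (∀ g, ∀ v ∈ W, l g v ∈ W) ∧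
      (∃ v ∈ W, l g₀ v ≠ v) ∧ Module.finrank ℂ W = n := by
    obtain ⟨W, h1, h2, h3⟩ := hex
    exact ⟨_, W, h1, h2, h3, rfl⟩
  obtain ⟨W, hfin, hW, hv, hn⟩ := Nat.find_spec hex'
  have hmin : ∀ V : Submodule ℂ H, V < W → (∀ g, ∀ v ∈ V, l g v ∈ V) → ∀ v ∈ V, l g₀ v = v := by
    intro V hV hVinv
    by_contra! hc
    have hlt := Submodule.finrank_lt_finrank_of_lt hV
    rw [hn] at hlt
    exact Nat.find_min hex' hlt
      ⟨V, Submodule.finiteDimensional_of_le hV.le, hVinv, hc, rfl⟩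
  have hadj := unitaryRep_inner_left l
  refine exists_unitaryIrrep_of_irreducible l hl W hW (fun W' hW' hinv => ?_) g₀ hv
  -- A proper nonzero invariant `W'` splits `W` into `W'` and `W'ᗮ ⊓ W`, both smaller than `W`. By
  -- minimality `g₀` fixes both pointwise, hence fixes `W`.
  by_contra! hne
  have : FiniteDimensional ℂ W' := Submodule.finiteDimensional_of_le hW'
  have hfix' := hmin W' (lt_of_le_of_ne hW' hne.2) hinv
  have hinv'' : ∀ g, ∀ v ∈ W'ᗮ ⊓ W, l g v ∈ W'ᗮ ⊓ W := by
    rintro g v ⟨hv1, hv2⟩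
    refine ⟨fun w hw => ?_, hW g v hv2⟩
    have h := hadj g⁻¹ w v
    rw [inv_inv] at h
    rw [← h]
    exact hv1 _ (hinv _ _ hw)
  have hlt : W'ᗮ ⊓ W < W := by
    refine lt_of_le_of_ne inf_le_right fun h => hne.1 ?_
    have hle : W' ≤ W'ᗮ := hW'.trans (inf_eq_right.1 h)
    rw [← disjoint_self]
    exact W'.orthogonal_disjoint.mono_right hle
  have hfix'' := hmin _ hlt hinv''
  obtain ⟨v, hvW, hvne⟩ := hv
  rw [← Submodule.sup_orthogonal_inf_of_hasOrthogonalProjection hW'] at hvW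
  obtain ⟨a, ha, c, hc, rfl⟩ := Submodule.mem_sup.1 hvW
  exact hvne (by rw [map_add, hfix' a ha, hfix'' c hc])

variable [IsTopologicalGroup G] [CompactSpace G] [MeasurableSpace G] [BorelSpace G]

instance : IsProbabilityMeasure (haarProb G) := ⟨by
  simpa [haarProb] using Measure.haarMeasure_self (K₀ := (⊤ : TopologicalSpace.PositiveCompacts G))⟩

instance : (haarProb G).IsHaarMeasure := by unfold haarProb; infer_instance

instance : (haarProb G).Regular := by unfold haarProb; infer_instance

theorem integrable_haarProb {E : Type*} [NormedAddCommGroup E] {f : G → E} (hf : Continuous f) :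
    Integrable f (haarProb G) :=
  hf.integrable_of_hasCompactSupport (HasCompactSupport.of_compactSpace f)

/-- Averaging a rank one projection over the group gives a compact operator that commutes with the
representation; its eigenspaces are finite-dimensional and invariant. -/
theorem exists_finiteDimensional_invariant {H : Type*} [NormedAddCommGroup H]
    [InnerProductSpace ℂ H] [CompleteSpace H] (l : G →* (H →ₗᵢ[ℂ] H))
    (hl : ∀ v, Continuous fun g => l g v) (g₀ : G) (f : H) (hf : l g₀⁻¹ f ≠ f) :
    ∃ W : Submodule ℂ H, FiniteDimensional ℂ W ∧ (∀ g, ∀ v ∈ W, l g v ∈ W) ∧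
      ∃ v ∈ W, l g₀ v ≠ v := by
  by_contra! hcon
  have hadj := unitaryRep_inner_left l
  set R : G → H →L[ℂ] H := fun g => InnerProductSpace.rankOne ℂ (l g f) (l g f) with hR
  have hRc : Continuous R :=
    ((ContinuousLinearMap.smulRightL ℂ H H).continuous.comp
      ((innerSL ℂ).continuous.comp (hl f))).clm_apply (hl f)
  have hRi := integrable_haarProb hRc
  set K : H →L[ℂ] H := ∫ g, R g ∂(haarProb G) with hK
  have hKapp : ∀ w, K w = ∫ g, inner ℂ (l g f) w • l g f ∂(haarProb G) := by
    intro w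
    rw [hK, ContinuousLinearMap.integral_apply hRi]; rfl
  have hint : ∀ w, Integrable (fun g => inner ℂ (l g f) w • l g f) (haarProb G) := fun w =>
    integrable_haarProb (((hl f).inner continuous_const).smul (hl f))
  have hKin : ∀ v w, inner ℂ v (K w)
      = ∫ g, inner ℂ (l g f) w * inner ℂ v (l g f) ∂(haarProb G) := by
    intro v w
    rw [hKapp, ← integral_inner (hint w)]
    simp only [inner_smul_right]
  have hsymm : (K : H →ₗ[ℂ] H).IsSymmetric := by
    intro v w
    change inner ℂ (K v) w = inner ℂ v (K w)
    rw [← inner_conj_symm, hKin, hKin, ← integral_conj]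
    refine integral_congr_ae (Filter.Eventually.of_forall fun g => ?_)
    simp only [map_mul, inner_conj_symm]
    rw [mul_comm]
  have hcomm : ∀ h w, l h (K w) = K (l h w) := by
    intro h w
    rw [hKapp, hKapp]
    have h1 := (l h).toContinuousLinearMap.integral_comp_comm (hint w)
    have h2 := integral_mul_left_eq_self (μ := haarProb G)
      (fun g => inner ℂ (l g f) (l h w) • l g f) h
    rw [← h2]
    refine h1.symm.trans (integral_congr_ae (Filter.Eventually.of_forall fun g => ?_))
    simp only [unitaryRep_mul_apply, LinearIsometry.inner_map_map]
    exact (l h).map_smul _ _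
  -- The compact operators form a closed convex set, so an average of rank one operators stays
  -- compact.
  have hcomp : IsCompactOperator K := by
    have hmem : K ∈ {T : H →L[ℂ] H | IsCompactOperator T} := by
      refine Convex.integral_mem (μ := haarProb G) ?_ ?_ (Filter.Eventually.of_forall fun g => ?_) hRi
      · intro S hS T hT a b _ _ _
        exact (IsCompactOperator.smul hS a).add (IsCompactOperator.smul hT b)
      · exact isClosed_setOfPred_isCompactOperator
      · have h : IsCompactOperator (innerSL ℂ (l g f)) :=
          isCompactOperator_of_locallyCompactSpace_dom _
        exact h.clm_comp (ContinuousLinearMap.toSpanSingleton ℂ (l g f))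
    exact hmem
  -- `(K v, v) = ∫ |(l g f, v)|² dg`, and a continuous nonnegative function with zero Haar integral
  -- vanishes everywhere.
  have hker : ∀ v, K v = 0 → ∀ g, inner ℂ (l g f) v = 0 := by
    intro v hv
    have h1 := hKin v v
    rw [hv, inner_zero_right] at h1
    have h2 : ∫ g, ‖inner ℂ (l g f) v‖ ^ 2 ∂(haarProb G) = 0 := by
      rw [← Complex.ofReal_inj, Complex.ofReal_zero, h1, ← integral_complex_ofReal]
      refine integral_congr_ae (Filter.Eventually.of_forall fun g => ?_)
      simp only
      rw [← inner_conj_symm v, Complex.mul_conj']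
      push_cast; rfl
    have hc : Continuous fun g => ‖inner ℂ (l g f) v‖ ^ 2 :=
      ((hl f).inner continuous_const).norm.pow 2
    rw [integral_eq_zero_iff_of_nonneg (fun g => by positivity) (integrable_haarProb hc)] at h2
    have h3 := (hc.ae_eq_iff_eq (haarProb G) continuous_const).1 h2
    intro g
    have h4 : ‖inner ℂ (l g f) v‖ ^ 2 = 0 := congrFun h3 g
    simpa using h4
  -- If `g₀` acted trivially on every finite-dimensional invariant subspace, it would fix the
  -- eigenspaces for `μ ≠ 0`. The kernel may be infinite-dimensional, but it is orthogonal to the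
  -- whole orbit of `f`. So `l g₀⁻¹ f - f` is orthogonal to all eigenspaces and vanishes by the
  -- spectral theorem.
  have hperp : l g₀⁻¹ f - f ∈ (⨆ μ, Module.End.eigenspace (K : Module.End ℂ H) μ)ᗮ := by
    rw [Submodule.mem_orthogonal']
    have hle : (⨆ μ, Module.End.eigenspace (K : Module.End ℂ H) μ)
        ≤ LinearMap.ker (innerₛₗ ℂ (l g₀⁻¹ f - f)) := by
      refine iSup_le fun μ v hv => ?_
      rw [LinearMap.mem_ker, innerₛₗ_apply_apply, inner_sub_left, sub_eq_zero]
      rcases eq_or_ne μ 0 with rfl | hμ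
      · have hv0 : K v = 0 := by simpa using hv
        have h1 := hker v hv0 1
        rw [unitaryRep_one_apply] at h1
        rw [h1, hker v hv0]
      · have := ContinuousLinearMap.finite_dimensional_eigenspace hcomp μ hμ
        have h2 := hcon (Module.End.eigenspace (K : Module.End ℂ H) μ) this (fun g w hw => ?_) v hv
        · rw [hadj, inv_inv, h2]
        · rw [Module.End.mem_eigenspace_iff] at hw ⊢
          change K (l g w) = _
          rw [← hcomm, show K w = μ • w from hw, map_smul]
    intro u hu
    exact hle hu
  rw [ContinuousLinearMap.orthogonalComplement_iSup_eigenspaces_eq_bot hcomp hsymm,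
    Submodule.mem_bot, sub_eq_zero] at hperp
  exact hf hperp

/-- Left translation `f ↦ f(g⁻¹ ·)` on `L²(G)`. -/
noncomputable def leftRegular : G →* (Lp ℂ 2 (haarProb G) →ₗᵢ[ℂ] Lp ℂ 2 (haarProb G)) where
  toFun g := Lp.compMeasurePreservingₗᵢ ℂ (g⁻¹ • ·) (measurePreserving_smul g⁻¹ (haarProb G))
  map_one' := by
    ext1 f
    have := one_smul Gᵈᵐᵃ f
    rw [← DomMulAct.mk_one, ← inv_one] at this
    exact this
  map_mul' g h := by
    ext1 f
    have := mul_smul (DomMulAct.mk g⁻¹) (DomMulAct.mk h⁻¹) f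
    rw [← DomMulAct.mk_mul, ← mul_inv_rev] at this
    exact this

theorem leftRegular_ae_eq (g : G) (f : Lp ℂ 2 (haarProb G)) :
    leftRegular g f =ᵐ[haarProb G] fun t => f (g⁻¹ * t) :=
  Lp.coeFn_compMeasurePreserving f (measurePreserving_smul g⁻¹ (haarProb G))

theorem leftRegular_toLp (g : G) (f : C(G, ℂ)) :
    leftRegular g (ContinuousMap.toLp 2 (haarProb G) ℂ f)
      = ContinuousMap.toLp 2 (haarProb G) ℂ (f.comp ⟨fun t => g⁻¹ * t, by fun_prop⟩) := rfl

theorem continuous_leftRegular (f : Lp ℂ 2 (haarProb G)) : Continuous fun g => leftRegular g f := by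
  have : Fact ((2 : ℝ≥0∞) ≠ ∞) := ⟨by simp⟩
  have h : Continuous fun g : G => DomMulAct.mk g⁻¹ • f :=
    (DomMulAct.continuous_mk.comp continuous_inv).smul continuous_const
  exact h

variable [T2Space G]

/-- The irreducible representations of a compact group separate its points. -/
theorem exists_unitaryIrrep_mat_ne_one {g : G} (hg : g ≠ 1) : ∃ π : UnitaryIrrep G, π.mat g ≠ 1 := by
  obtain ⟨f, hf1, hf2, -⟩ := exists_continuous_zero_one_of_isClosed
    (isClosed_singleton (x := g)) (isClosed_singleton (x := (1 : G))) (by simpa using hg)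
  let φ : C(G, ℂ) := ⟨fun t => (f t : ℂ), by fun_prop⟩
  refine exists_unitaryIrrep_of_finiteDimensional leftRegular continuous_leftRegular g
    (exists_finiteDimensional_invariant leftRegular continuous_leftRegular g
      (ContinuousMap.toLp 2 (haarProb G) ℂ φ) fun h => ?_)
  -- Haar measure charges open sets, so equality in `L²` of continuous functions is pointwise
  -- equality; at `1` it would read `f g = f 1`, that is `0 = 1`.
  rw [leftRegular_toLp] at h
  have h' := ContinuousMap.toLp_injective (haarProb G) h
  have := DFunLike.congr_fun h' 1
  have h1 := hf1 rfl
  have h2 := hf2 rfl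
  simp [φ, h1, h2] at this

end PeterWeyl

/-! ### Schur's lemma and the orthogonality relations -/

section Schur

open scoped ComplexConjugate

variable {G : Type u} [Group G] [TopologicalSpace G]

theorem Dual.mat_one (π : Dual G) : π.mat 1 = 1 :=
  congrArg Subtype.val (map_one π.rep.toHom)

theorem Dual.mat_mul (π : Dual G) (s t : G) : π.mat (s * t) = π.mat s * π.mat t :=
  congrArg Subtype.val (map_mul π.rep.toHom s t)

theorem Dual.mat_mem_unitaryGroup (π : Dual G) (s : G) :
    π.mat s ∈ Matrix.unitaryGroup (Fin π.dim) ℂ := (π.rep.toHom s).2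

theorem Dual.conjTranspose_mul_mat (π : Dual G) (s : G) : (π.mat s)ᴴ * π.mat s = 1 :=
  Matrix.mem_unitaryGroup_iff'.1 (π.mat_mem_unitaryGroup s)

theorem Dual.mat_mul_conjTranspose (π : Dual G) (s : G) : π.mat s * (π.mat s)ᴴ = 1 :=
  Matrix.mem_unitaryGroup_iff.1 (π.mat_mem_unitaryGroup s)

theorem Dual.mat_inv (π : Dual G) (s : G) : π.mat s⁻¹ = (π.mat s)ᴴ := by
  have h : π.mat s⁻¹ * π.mat s = 1 := by rw [← π.mat_mul, inv_mul_cancel, π.mat_one]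
  calc π.mat s⁻¹ = π.mat s⁻¹ * (π.mat s * (π.mat s)ᴴ) := by
        rw [π.mat_mul_conjTranspose, Matrix.mul_one]
    _ = (π.mat s)ᴴ := by rw [← Matrix.mul_assoc, h, Matrix.one_mul]

theorem Dual.continuous_mat (π : Dual G) : Continuous π.mat := π.rep.continuous_toHom

theorem Dual.dim_pos (π : Dual G) : 0 < π.dim := π.rep.dim_pos

theorem Dual.dim_ne_zero (π : Dual G) : (π.dim : ℂ) ≠ 0 := by
  exact_mod_cast π.dim_pos.ne'

/-- **Schur's lemma**: a matrix commuting with an irreducible representation is scalar. -/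
theorem Dual.exists_eq_smul_one (π : Dual G) (M : Matrix (Fin π.dim) (Fin π.dim) ℂ)
    (hM : ∀ s, π.mat s * M = M * π.mat s) : ∃ c : ℂ, M = c • 1 := by
  have : Nonempty (Fin π.dim) := ⟨⟨0, π.dim_pos⟩⟩
  obtain ⟨c, hc⟩ := Module.End.exists_eigenvalue (Matrix.mulVecLin M)
  refine ⟨c, ?_⟩
  have hinv : ∀ s, ∀ v ∈ Module.End.eigenspace (Matrix.mulVecLin M) c,
      π.mat s *ᵥ v ∈ Module.End.eigenspace (Matrix.mulVecLin M) c := by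
    intro s v hv
    rw [Module.End.mem_eigenspace_iff, Matrix.mulVecLin_apply] at hv ⊢
    rw [Matrix.mulVec_mulVec, ← hM, ← Matrix.mulVec_mulVec, hv, Matrix.mulVec_smul]
  have htop : Module.End.eigenspace (Matrix.mulVecLin M) c = ⊤ :=
    (π.rep.irreducible _ hinv).resolve_left hc
  apply Matrix.mulVec_injective
  funext v
  have hv : v ∈ Module.End.eigenspace (Matrix.mulVecLin M) c := by rw [htop]; trivial
  rw [Module.End.mem_eigenspace_iff] at hv
  rw [Matrix.smul_mulVec, Matrix.one_mulVec]
  exact hv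

theorem Dual.conjTranspose_intertwines {π σ : Dual G} {T : Matrix (Fin π.dim) (Fin σ.dim) ℂ}
    (hT : ∀ s, π.mat s * T = T * σ.mat s) (s : G) : σ.mat s * Tᴴ = Tᴴ * π.mat s := by
  have h := congrArg Matrix.conjTranspose (hT s⁻¹)
  rw [Matrix.conjTranspose_mul, Matrix.conjTranspose_mul, π.mat_inv, σ.mat_inv,
    Matrix.conjTranspose_conjTranspose, Matrix.conjTranspose_conjTranspose] at h
  exact h.symm

/-- By Schur's lemma `T Tᴴ` and `Tᴴ T` are scalars. They agree because `(T Tᴴ) T = T (Tᴴ T)`, and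
the common value is positive, so rescaling `T` by its inverse square root gives a unitary
equivalence. -/
theorem Dual.eq_of_intertwiner_ne_zero {π σ : Dual G} {T : Matrix (Fin π.dim) (Fin σ.dim) ℂ}
    (hT : ∀ s, π.mat s * T = T * σ.mat s) (h0 : T ≠ 0) : π = σ := by
  have hT' := Dual.conjTranspose_intertwines hT
  obtain ⟨c, hc⟩ := π.exists_eq_smul_one (T * Tᴴ) fun s => by
    rw [← Matrix.mul_assoc, hT, Matrix.mul_assoc, hT', Matrix.mul_assoc]
  obtain ⟨c', hc'⟩ := σ.exists_eq_smul_one (Tᴴ * T) fun s => by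
    rw [← Matrix.mul_assoc, hT', Matrix.mul_assoc, hT, Matrix.mul_assoc]
  have hcc : c = c' := by
    have h : c • T = c' • T := by
      calc c • T = (T * Tᴴ) * T := by rw [hc, Matrix.smul_mul, Matrix.one_mul]
        _ = c' • T := by rw [Matrix.mul_assoc, hc', Matrix.mul_smul, Matrix.mul_one]
    exact smul_left_injective ℂ h0 h
  subst hcc
  set r : ℝ := ∑ j, ‖T ⟨0, π.dim_pos⟩ j‖ ^ 2 with hr
  have hcr : c = (r : ℂ) := by
    have h := congrFun (congrFun hc ⟨0, π.dim_pos⟩) ⟨0, π.dim_pos⟩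
    rw [Matrix.smul_apply, Matrix.one_apply_eq, smul_eq_mul, mul_one, Matrix.mul_apply] at h
    rw [← h, hr]
    push_cast
    refine Finset.sum_congr rfl fun j _ => ?_
    rw [Matrix.conjTranspose_apply]
    exact Complex.mul_conj' _
  have hc0 : c ≠ 0 := by
    rintro rfl
    rw [zero_smul] at hc
    open scoped ComplexOrder in
    exact h0 (Matrix.self_mul_conjTranspose_eq_zero.1 hc)
  have hr0 : 0 < r := lt_of_le_of_ne (Finset.sum_nonneg fun j _ => by positivity) fun h => hc0 (by
    rw [hcr, ← h, Complex.ofReal_zero])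
  have hsq : (((Real.sqrt r)⁻¹ : ℝ) : ℂ) * ((Real.sqrt r)⁻¹ : ℝ) * c = 1 := by
    rw [hcr, ← Complex.ofReal_mul, ← Complex.ofReal_mul, ← mul_inv, Real.mul_self_sqrt hr0.le,
      inv_mul_cancel₀ hr0.ne', Complex.ofReal_one]
  set q : ℂ := (((Real.sqrt r)⁻¹ : ℝ) : ℂ) with hq
  have hstar : star q = q := Complex.conj_ofReal _
  have h1 : (q • T) * (q • T)ᴴ = 1 := by
    rw [Matrix.conjTranspose_smul, Matrix.smul_mul, Matrix.mul_smul, smul_smul, hc, smul_smul,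
      hstar, hsq, one_smul]
  have h2 : (q • T)ᴴ * (q • T) = 1 := by
    rw [Matrix.conjTranspose_smul, Matrix.smul_mul, Matrix.mul_smul, smul_smul, hc', smul_smul,
      hstar, hsq, one_smul]
  have h3 : ∀ s, π.mat s * (q • T) = (q • T) * σ.mat s := fun s => by
    rw [Matrix.smul_mul, Matrix.mul_smul, hT]
  have hequiv : π.rep ≈ σ.rep := ⟨q • T, h1, h2, h3⟩
  exact Quotient.out_equiv_out.1 hequiv

theorem trigFun_apply (π : Dual G) (A : Matrix (Fin π.dim) (Fin π.dim) ℂ) (s : G) :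
    trigFun π A s = (π.dim : ℂ) * (A * π.mat s).trace := rfl

variable [IsTopologicalGroup G] [CompactSpace G] [MeasurableSpace G] [BorelSpace G]

theorem Dual.integrable_mat_mul_conj (π σ : Dual G) (i k : Fin π.dim) (j l : Fin σ.dim) :
    Integrable (fun s => π.mat s i k * conj (σ.mat s j l)) (haarProb G) :=
  integrable_haarProb ((π.continuous_mat.matrix_elem i k).mul
    (Complex.continuous_conj.comp (σ.continuous_mat.matrix_elem j l)))

/-- The matrix `∫ π(s) E_{kl} σ(s)ᴴ ds`. -/
noncomputable def averagedUnit (π σ : Dual G) (k : Fin π.dim) (l : Fin σ.dim) :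
    Matrix (Fin π.dim) (Fin σ.dim) ℂ :=
  Matrix.of fun i j => ∫ s, π.mat s i k * conj (σ.mat s j l) ∂(haarProb G)

/-- Invariance of Haar measure under `s ↦ t s`, combined with unitarity of `σ`. -/
theorem averagedUnit_intertwines (π σ : Dual G) (k : Fin π.dim) (l : Fin σ.dim) (t : G) :
    π.mat t * averagedUnit π σ k l = averagedUnit π σ k l * σ.mat t := by
  ext i j
  simp only [Matrix.mul_apply, averagedUnit, Matrix.of_apply]
  simp_rw [← integral_const_mul, ← integral_mul_const]
  rw [← integral_finsetSum _ fun m _ => (π.integrable_mat_mul_conj σ m k j l).const_mul _,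
    ← integral_finsetSum _ fun m _ => (π.integrable_mat_mul_conj σ i k m l).mul_const _]
  refine Eq.trans ?_ (integral_mul_left_eq_self (μ := haarProb G) _ t)
  refine integral_congr_ae (Filter.Eventually.of_forall fun s => ?_)
  have h1 : ∑ m, conj (σ.mat (t * s) m l) * σ.mat t m j = conj (σ.mat s j l) := by
    have h2 : (σ.mat (t * s))ᴴ * σ.mat t = (σ.mat s)ᴴ := by
      rw [σ.mat_mul, Matrix.conjTranspose_mul, Matrix.mul_assoc, σ.conjTranspose_mul_mat,
        Matrix.mul_one]
    have h3 := congrFun (congrFun h2 l) j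
    rw [Matrix.mul_apply] at h3
    exact h3
  simp only
  calc ∑ m, π.mat t i m * (π.mat s m k * conj (σ.mat s j l))
      = (∑ m, π.mat t i m * π.mat s m k) * conj (σ.mat s j l) := by
        rw [Finset.sum_mul]
        exact Finset.sum_congr rfl fun m _ => by ring
    _ = π.mat (t * s) i k * conj (σ.mat s j l) := by rw [π.mat_mul, Matrix.mul_apply]
    _ = _ := by
        rw [← h1, Finset.mul_sum]
        exact Finset.sum_congr rfl fun m _ => by ring

theorem integral_mat_mul_conj_of_ne {π σ : Dual G} (h : π ≠ σ) (i k : Fin π.dim)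
    (j l : Fin σ.dim) : ∫ s, π.mat s i k * conj (σ.mat s j l) ∂(haarProb G) = 0 := by
  by_contra hne
  refine h (Dual.eq_of_intertwiner_ne_zero (averagedUnit_intertwines π σ k l) fun h0 => hne ?_)
  exact congrFun (congrFun h0 i) j

/-- The averaged matrix is a scalar by Schur's lemma. Its trace is `δ_kl`, because the columns of a
unitary matrix are orthonormal, and this fixes the scalar as `δ_kl / d_π`. -/
theorem integral_mat_mul_conj_self (π : Dual G) (i k j l : Fin π.dim) :
    ∫ s, π.mat s i k * conj (π.mat s j l) ∂(haarProb G)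
      = if i = j then (if k = l then (π.dim : ℂ)⁻¹ else 0) else 0 := by
  obtain ⟨c, hc⟩ := π.exists_eq_smul_one _ (averagedUnit_intertwines π π k l)
  have htr : (averagedUnit π π k l).trace = if k = l then 1 else 0 := by
    simp only [Matrix.trace, Matrix.diag_apply, averagedUnit, Matrix.of_apply]
    rw [← integral_finsetSum _ fun m _ => π.integrable_mat_mul_conj π m k m l]
    have h : ∀ s, ∑ m, π.mat s m k * conj (π.mat s m l) = if k = l then 1 else 0 := by
      intro s
      have h2 := congrFun (congrFun (π.conjTranspose_mul_mat s) l) k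
      rw [Matrix.mul_apply, Matrix.one_apply] at h2
      simp only [Matrix.conjTranspose_apply, eq_comm (a := l)] at h2
      rw [← h2]
      exact Finset.sum_congr rfl fun m _ => mul_comm _ _
    simp_rw [h]
    simp
  rw [hc, Matrix.trace_smul, Matrix.trace_one, Fintype.card_fin, smul_eq_mul] at htr
  have hval : ∫ s, π.mat s i k * conj (π.mat s j l) ∂(haarProb G)
      = (c • (1 : Matrix (Fin π.dim) (Fin π.dim) ℂ)) i j := congrFun (congrFun hc i) j
  rw [hval, Matrix.smul_apply, Matrix.one_apply, smul_eq_mul, eq_div_of_mul_eq π.dim_ne_zero htr]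
  split_ifs <;> simp

theorem integral_trigFun_mul_conj (π σ : Dual G) (A : Matrix (Fin π.dim) (Fin π.dim) ℂ)
    (B : Matrix (Fin σ.dim) (Fin σ.dim) ℂ) :
    ∫ s, trigFun π A s * conj (trigFun σ B s) ∂(haarProb G)
      = ∑ k, ∑ i, ∑ l, ∑ j, (π.dim : ℂ) * σ.dim * A k i * conj (B l j)
          * ∫ s, π.mat s i k * conj (σ.mat s j l) ∂(haarProb G) := by
  have hint := π.integrable_mat_mul_conj σ
  have h : ∀ s, trigFun π A s * conj (trigFun σ B s)
      = ∑ k, ∑ i, ∑ l, ∑ j, (π.dim : ℂ) * σ.dim * A k i * conj (B l j)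
          * (π.mat s i k * conj (σ.mat s j l)) := by
    intro s
    simp only [trigFun_apply, Matrix.trace, Matrix.diag_apply, Matrix.mul_apply, map_mul, map_sum,
      map_natCast]
    rw [mul_mul_mul_comm, Finset.sum_mul, Finset.mul_sum]
    refine Finset.sum_congr rfl fun k _ => ?_
    rw [Finset.sum_mul, Finset.mul_sum]
    refine Finset.sum_congr rfl fun i _ => ?_
    rw [Finset.mul_sum, Finset.mul_sum]
    refine Finset.sum_congr rfl fun l _ => ?_
    rw [Finset.mul_sum, Finset.mul_sum]
    refine Finset.sum_congr rfl fun j _ => ?_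
    ring
  simp_rw [h]
  rw [integral_finsetSum _ fun k _ => integrable_finsetSum _ fun i _ => integrable_finsetSum _
    fun l _ => integrable_finsetSum _ fun j _ => (hint i k j l).const_mul _]
  refine Finset.sum_congr rfl fun k _ => ?_
  rw [integral_finsetSum _ fun i _ => integrable_finsetSum _
    fun l _ => integrable_finsetSum _ fun j _ => (hint i k j l).const_mul _]
  refine Finset.sum_congr rfl fun i _ => ?_
  rw [integral_finsetSum _
    fun l _ => integrable_finsetSum _ fun j _ => (hint i k j l).const_mul _]
  refine Finset.sum_congr rfl fun l _ => ?_
  rw [integral_finsetSum _ fun j _ => (hint i k j l).const_mul _]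
  refine Finset.sum_congr rfl fun j _ => ?_
  rw [integral_const_mul]

/-- The element of `L²(G)` given by `s ↦ d_π Tr(A π(s))`. -/
noncomputable def trigLp (π : Dual G) :
    Matrix (Fin π.dim) (Fin π.dim) ℂ →ₗ[ℂ] Lp ℂ 2 (haarProb G) where
  toFun A := ContinuousMap.toLp 2 (haarProb G) ℂ (trigFun π A)
  map_add' A B := by
    rw [← map_add]
    congr 1
    ext s
    simp [trigFun_apply, add_mul, mul_add]
  map_smul' c A := by
    rw [RingHom.id_apply, ← map_smul]
    congr 1
    ext s
    simp [trigFun_apply, mul_left_comm]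

theorem inner_trigLp_of_ne {π σ : Dual G} (h : π ≠ σ) (A : Matrix (Fin π.dim) (Fin π.dim) ℂ)
    (B : Matrix (Fin σ.dim) (Fin σ.dim) ℂ) : inner ℂ (trigLp π A) (trigLp σ B) = 0 := by
  refine (ContinuousMap.inner_toLp _ _ _).trans ?_
  rw [integral_trigFun_mul_conj]
  simp [integral_mat_mul_conj_of_ne h.symm]

theorem inner_trigLp_self (π : Dual G) (A B : Matrix (Fin π.dim) (Fin π.dim) ℂ) :
    inner ℂ (trigLp π A) (trigLp π B) = (π.dim : ℂ) * (B * Aᴴ).trace := by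
  refine (ContinuousMap.inner_toLp _ _ _).trans ?_
  rw [integral_trigFun_mul_conj]
  simp only [integral_mat_mul_conj_self, mul_ite, mul_zero, Finset.sum_ite_eq, Finset.mem_univ,
    if_true]
  simp only [Matrix.trace, Matrix.diag_apply, Matrix.mul_apply, Finset.mul_sum]
  refine Finset.sum_congr rfl fun k _ => Finset.sum_congr rfl fun i _ => ?_
  rw [Matrix.conjTranspose_apply, RCLike.star_def]
  field_simp [π.dim_ne_zero]

end Schur

/-! ### `A_ω(G)` as a Banach space of functions -/

section BeurlingSpace

variable {G : Type u} [Group G] [TopologicalSpace G]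

theorem Weight.dim_mul_pos (ω : Weight G) (π : Dual G) : 0 < (π.dim : ℝ) * ω π :=
  mul_pos (by exact_mod_cast π.dim_pos) (ω.pos π)

/-- The squared Hilbert-Schmidt norm. -/
noncomputable def hsNormSq {m n : ℕ} (A : Matrix (Fin m) (Fin n) ℂ) : ℝ := ∑ i, ∑ j, ‖A i j‖ ^ 2

theorem hsNormSq_nonneg {m n : ℕ} (A : Matrix (Fin m) (Fin n) ℂ) : 0 ≤ hsNormSq A :=
  Finset.sum_nonneg fun _ _ => Finset.sum_nonneg fun _ _ => by positivity

theorem trace_mul_conjTranspose_self {m n : ℕ} (A : Matrix (Fin m) (Fin n) ℂ) :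
    (A * Aᴴ).trace = (hsNormSq A : ℂ) := by
  simp only [Matrix.trace, Matrix.diag_apply, Matrix.mul_apply, Matrix.conjTranspose_apply,
    hsNormSq, RCLike.star_def, Complex.mul_conj']
  push_cast
  rfl

theorem HSFiber.norm_sq {ω : Weight G} {π : Dual G} (A : HSFiber ω π) :
    ‖A‖ ^ 2 = (π.dim : ℝ) * ω π * hsNormSq A.toMatrix := by
  have h := HSFiber.inner_eq A A
  rw [trace_mul_conjTranspose_self, inner_self_eq_norm_sq_to_K] at h
  apply Complex.ofReal_injective
  rw [Complex.ofReal_mul, ← h, Complex.ofReal_pow]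
  rfl

theorem HSFiber.norm_eq {ω : Weight G} {π : Dual G} (A : HSFiber ω π) :
    ‖A‖ = Real.sqrt ((π.dim : ℝ) * ω π) * Real.sqrt (hsNormSq A.toMatrix) := by
  rw [← Real.sqrt_mul (ω.dim_mul_pos π).le, ← HSFiber.norm_sq, Real.sqrt_sq (norm_nonneg _)]

noncomputable instance (ω : Weight G) (π : Dual G) : FiniteDimensional ℂ (HSFiber ω π) :=
  inferInstanceAs (FiniteDimensional ℂ (Matrix (Fin π.dim) (Fin π.dim) ℂ))

instance (ω : Weight G) (π : Dual G) : CompleteSpace (HSFiber ω π) :=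
  FiniteDimensional.complete ℂ _

/-- The matrices on `ℂ ^ d_π` with the norm `‖A‖₁ d_π ω(π)`. -/
def TrFiber (_ω : Weight G) (π : Dual G) : Type := Matrix (Fin π.dim) (Fin π.dim) ℂ

namespace TrFiber

variable {ω : Weight G} {π : Dual G}

/-- The underlying matrix. -/
def toMatrix (A : TrFiber ω π) : Matrix (Fin π.dim) (Fin π.dim) ℂ := A

instance : AddCommGroup (TrFiber ω π) :=
  inferInstanceAs (AddCommGroup (Matrix (Fin π.dim) (Fin π.dim) ℂ))

instance : Module ℂ (TrFiber ω π) :=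
  inferInstanceAs (Module ℂ (Matrix (Fin π.dim) (Fin π.dim) ℂ))

noncomputable instance : Norm (TrFiber ω π) :=
  ⟨fun A => traceNorm A.toMatrix * π.dim * ω π⟩

theorem norm_def (A : TrFiber ω π) : ‖A‖ = traceNorm A.toMatrix * π.dim * ω π := rfl

theorem normCore (ω : Weight G) (π : Dual G) : NormedSpace.Core ℂ (TrFiber ω π) where
  norm_nonneg A := mul_nonneg (mul_nonneg (traceNorm_nonneg _) (Nat.cast_nonneg _)) (ω.pos π).le
  norm_smul c A := by
    have h : traceNorm (c • A).toMatrix = ‖c‖ * traceNorm A.toMatrix := traceNorm_smul c _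
    rw [norm_def, norm_def, h]
    ring
  norm_triangle A B := by
    have h : traceNorm (A + B).toMatrix ≤ traceNorm A.toMatrix + traceNorm B.toMatrix :=
      traceNorm_add_le _ _
    have := (ω.pos π).le
    rw [norm_def, norm_def, norm_def, ← add_mul, ← add_mul]
    gcongr
  norm_eq_zero_iff A := by
    constructor
    · intro h
      rw [norm_def, mul_assoc] at h
      exact traceNorm_eq_zero ((mul_eq_zero.1 h).resolve_right (ω.dim_mul_pos π).ne')
    · rintro rfl
      have h : traceNorm (0 : TrFiber ω π).toMatrix = 0 := traceNorm_zero
      rw [norm_def, h, zero_mul, zero_mul]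

noncomputable instance : NormedAddCommGroup (TrFiber ω π) :=
  NormedAddCommGroup.ofCore (normCore ω π)

noncomputable instance : NormedSpace ℂ (TrFiber ω π) :=
  NormedSpace.ofCore (normCore ω π)

end TrFiber

/-- The Banach space `A_ω(G)`, as an `ℓ¹`-sum. -/
abbrev BeurlingSpace (ω : Weight G) : Type u := lp (fun π : Dual G => TrFiber ω π) 1

namespace BeurlingSpace

variable {ω : Weight G}

/-- The underlying formal series. -/
def toSeries (u : BeurlingSpace ω) : Series G := fun π => (u π).toMatrix

theorem toSeries_sub (u v : BeurlingSpace ω) : (u - v).toSeries = u.toSeries - v.toSeries := rfl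

theorem summable_norm (u : BeurlingSpace ω) : Summable fun π => ‖u π‖ := by
  have h := (memℓp_gen_iff (p := 1) (by simp)).1 (lp.memℓp u)
  simpa using h

theorem norm_eq_tsum (u : BeurlingSpace ω) : ‖u‖ = ∑' π, ‖u π‖ := by
  rw [lp.norm_eq_tsum_rpow (by simp)]
  simp

theorem AOmegaNorm_toSeries (u : BeurlingSpace ω) :
    AOmegaNorm ω u.toSeries = ENNReal.ofReal ‖u‖ := by
  rw [norm_eq_tsum, ENNReal.ofReal_tsum_of_nonneg (fun π => norm_nonneg _) u.summable_norm]
  rfl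

theorem toSeries_mem (u : BeurlingSpace ω) : u.toSeries ∈ AOmega ω := by
  change AOmegaNorm ω u.toSeries < ∞
  rw [AOmegaNorm_toSeries]
  exact ENNReal.ofReal_lt_top

theorem exists_toSeries_eq {u : Series G} (hu : u ∈ AOmega ω) :
    ∃ v : BeurlingSpace ω, v.toSeries = u := by
  let v : ∀ π, TrFiber ω π := u
  have hv : Summable fun π => ‖v π‖ := by
    have h : ∑' π, ENNReal.ofReal ‖v π‖ ≠ ∞ := ne_of_lt hu
    simpa using ENNReal.summable_toReal h
  have hmem : Memℓp v 1 := (memℓp_gen_iff (by simp)).2 (by simpa using hv)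
  exact ⟨⟨v, hmem⟩, rfl⟩

section

open scoped Matrix.Norms.L2Operator

theorem norm_trace_mul_le (u : BeurlingSpace ω) (π : Dual G) (M : Matrix (Fin π.dim) (Fin π.dim) ℂ)
    {K : ℝ} (hM : ‖M‖ ≤ K * ω π) : ‖(π.dim : ℂ) * (u.toSeries π * M).trace‖ ≤ K * ‖u π‖ := by
  rw [norm_mul, Complex.norm_natCast]
  have h0 := traceNorm_nonneg (u.toSeries π)
  calc (π.dim : ℝ) * ‖(u.toSeries π * M).trace‖
      ≤ π.dim * (traceNorm (u.toSeries π) * (K * ω π)) := by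
        gcongr
        exact (BeurlingFourier.norm_trace_mul_le _ M).trans (by gcongr)
    _ = K * ‖u π‖ := by
        rw [TrFiber.norm_def]
        change _ = K * (traceNorm (u.toSeries π) * _ * _)
        ring

theorem summable_trace_mul (u : BeurlingSpace ω) {M : ∀ π : Dual G, Matrix (Fin π.dim) (Fin π.dim) ℂ}
    {K : ℝ} (hM : ∀ π, ‖M π‖ ≤ K * ω π) :
    Summable fun π : Dual G => (π.dim : ℂ) * (u.toSeries π * M π).trace :=
  Summable.of_norm_bounded (u.summable_norm.mul_left K) fun π => u.norm_trace_mul_le π (M π) (hM π)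

/-- A field of matrices dominated by `ω` acts as a bounded functional. This serves for point
evaluation, `M π = π(s)`, and in part (ii) for the difference of two evaluations, `M π = π(g) - 1`.
-/
theorem norm_tsum_trace_mul_le (u : BeurlingSpace ω)
    {M : ∀ π : Dual G, Matrix (Fin π.dim) (Fin π.dim) ℂ} {K : ℝ} (hM : ∀ π, ‖M π‖ ≤ K * ω π) :
    ‖∑' π : Dual G, (π.dim : ℂ) * (u.toSeries π * M π).trace‖ ≤ K * ‖u‖ := by
  rw [norm_eq_tsum, ← tsum_mul_left]
  exact tsum_of_norm_bounded (u.summable_norm.mul_left K).hasSum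
    fun π => u.norm_trace_mul_le π (M π) (hM π)

theorem norm_mat_le {c : ℝ} (hc : 0 < c) (hω : ∀ π, c ≤ ω π) (s : G) (π : Dual G) :
    ‖π.mat s‖ ≤ c⁻¹ * ω π := by
  rw [norm_eq_one_of_mem_unitary_of_pos π.dim_pos (π.mat_mem_unitaryGroup s), ← div_eq_inv_mul,
    one_le_div hc]
  exact hω π

theorem summable_eval (hω : ω.IsBounded) (u : BeurlingSpace ω) (s : G) :
    Summable fun π : Dual G => (π.dim : ℂ) * (u.toSeries π * π.mat s).trace := by
  obtain ⟨c, hc, hω⟩ := hω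
  exact u.summable_trace_mul (norm_mat_le hc hω s)

theorem norm_evalSeries_le {c : ℝ} (hc : 0 < c) (hω : ∀ π, c ≤ ω π) (u : BeurlingSpace ω) (s : G) :
    ‖evalSeries u.toSeries s‖ ≤ c⁻¹ * ‖u‖ :=
  u.norm_tsum_trace_mul_le (norm_mat_le hc hω s)

end

theorem evalSeries_add (hω : ω.IsBounded) (u v : BeurlingSpace ω) (s : G) :
    evalSeries (u + v).toSeries s = evalSeries u.toSeries s + evalSeries v.toSeries s := by
  rw [evalSeries, evalSeries, evalSeries,
    ← (summable_eval hω u s).tsum_add (summable_eval hω v s)]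
  refine tsum_congr fun π => ?_
  rw [← mul_add, ← Matrix.trace_add, ← Matrix.add_mul]
  rfl

theorem evalSeries_smul (c : ℂ) (u : BeurlingSpace ω) (s : G) :
    evalSeries (c • u).toSeries s = c * evalSeries u.toSeries s := by
  rw [evalSeries, evalSeries, ← tsum_mul_left]
  refine tsum_congr fun π => ?_
  rw [mul_left_comm, ← smul_eq_mul c, ← Matrix.trace_smul, ← Matrix.smul_mul]
  rfl

theorem evalSeries_zero (s : G) : evalSeries (0 : BeurlingSpace ω).toSeries s = 0 := by
  simpa using evalSeries_smul (0 : ℂ) (0 : BeurlingSpace ω) s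

theorem evalSeries_sub (hω : ω.IsBounded) (u v : BeurlingSpace ω) (s : G) :
    evalSeries (u - v).toSeries s = evalSeries u.toSeries s - evalSeries v.toSeries s := by
  have h := evalSeries_smul (-1 : ℂ) v s
  rw [sub_eq_add_neg, ← neg_one_smul ℂ v, evalSeries_add hω, h]
  ring

/-- The elements of `A_ω(G)` vanishing on a neighbourhood of `E`, as a subspace. -/
def vanishingNear (hω : ω.IsBounded) (E : Set G) : Submodule ℂ (BeurlingSpace ω) where
  carrier := {u | ∃ U ∈ 𝓝ˢ E, ∀ s ∈ U, evalSeries u.toSeries s = 0}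
  zero_mem' := ⟨Set.univ, Filter.univ_mem, fun s _ => evalSeries_zero s⟩
  add_mem' := by
    rintro u v ⟨U, hU, hu⟩ ⟨V, hV, hv⟩
    exact ⟨U ∩ V, Filter.inter_mem hU hV, fun s hs => by
      rw [evalSeries_add hω, hu s hs.1, hv s hs.2, add_zero]⟩
  smul_mem' := by
    rintro c u ⟨U, hU, hu⟩
    exact ⟨U, hU, fun s hs => by rw [evalSeries_smul, hu s hs, mul_zero]⟩

/-- Turns the ideal into the norm closure of a subspace, to which Hahn-Banach applies. -/
theorem toSeries_mem_idealJ_iff (hω : ω.IsBounded) (E : Set G) (u : BeurlingSpace ω) :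
    u.toSeries ∈ idealJ ω E ↔ u ∈ closure (vanishingNear hω E : Set (BeurlingSpace ω)) := by
  rw [EMetric.mem_closure_iff]
  have hdist : ∀ v : BeurlingSpace ω, AOmegaNorm ω (u.toSeries - v.toSeries) = edist u v := by
    intro v
    rw [← toSeries_sub, AOmegaNorm_toSeries, edist_eq_enorm_sub, ofReal_norm]
  constructor
  · rintro ⟨-, h⟩ ε hε
    obtain ⟨v, ⟨hvA, hv0⟩, hv⟩ := h ε hε
    obtain ⟨v, rfl⟩ := exists_toSeries_eq hvA
    exact ⟨v, hv0, by rwa [← hdist]⟩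
  · intro h
    refine ⟨u.toSeries_mem, fun ε hε => ?_⟩
    obtain ⟨v, hv0, hv⟩ := h ε hε
    exact ⟨v.toSeries, ⟨v.toSeries_mem, hv0⟩, by rwa [hdist]⟩

/-- Point evaluations are continuous because `ω` is bounded below. -/
theorem idealJ_subset_idealI (hω : ω.IsBounded) (E : Set G) : idealJ ω E ⊆ idealI ω E := by
  rintro u hu
  refine ⟨hu.1, fun s hs => ?_⟩
  obtain ⟨u, rfl⟩ := exists_toSeries_eq hu.1
  rw [toSeries_mem_idealJ_iff hω] at hu
  obtain ⟨c, hc, hcω⟩ := hω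
  have hω : ω.IsBounded := ⟨c, hc, hcω⟩
  rw [← norm_le_zero_iff]
  refine le_of_forall_pos_lt_add fun ε hε => ?_
  obtain ⟨v, ⟨U, hU, hv⟩, huv⟩ := Metric.mem_closure_iff.1 hu (c * ε) (mul_pos hc hε)
  have h1 := norm_evalSeries_le hc hcω (u - v) s
  rw [evalSeries_sub hω, hv s (subset_of_mem_nhdsSet hU hs), sub_zero, ← dist_eq_norm] at h1
  calc _ ≤ c⁻¹ * dist u v := h1
    _ < c⁻¹ * (c * ε) := by gcongr
    _ = 0 + ε := by rw [inv_mul_cancel_left₀ hc.ne', zero_add]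

/-- Hahn-Banach separation of a point from the closure of a subspace. -/
theorem _root_.BeurlingFourier.exists_dual_eq_zero_of_notMem_closure {V : Type*}
    [NormedAddCommGroup V] [NormedSpace ℂ V] (p : Submodule ℂ V) {x : V}
    (hx : x ∉ closure (p : Set V)) : ∃ T : V →L[ℂ] ℂ, (∀ v ∈ p, T v = 0) ∧ T x ≠ 0 := by
  -- `p` need not be closed, so the quotient is only seminormed, but its seminorm vanishes exactly
  -- on the closure of `p`. A functional not vanishing at the class of `x` then pulls back to `V`.
  have hne : ‖(p.mkQL x : V ⧸ p)‖ ≠ 0 := by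
    intro h
    exact hx ((QuotientAddGroup.norm_mk_eq_zero_iff_mem_closure (S := p.toAddSubgroup)).1 h)
  obtain ⟨g, -, hg⟩ := exists_dual_vector ℂ (p.mkQL x) hne
  refine ⟨g ∘L p.mkQL, fun v hv => ?_, ?_⟩
  · have : p.mkQL v = 0 := (Submodule.Quotient.mk_eq_zero p).2 hv
    rw [ContinuousLinearMap.comp_apply, this, map_zero]
  · rw [ContinuousLinearMap.comp_apply, hg]
    simpa using hne

end BeurlingSpace

end BeurlingSpace

/-! ### Convolutions, operators defined by functionals, and their supports -/

section Convolution

open scoped ComplexConjugate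

variable {G : Type u} [Group G] [TopologicalSpace G]

section

variable {ω : Weight G}

theorem summable_norm_mul_norm (f g : L2Omega ω) : Summable fun π => ‖f π‖ * ‖g π‖ :=
  lp.summable_mul (by simpa using Real.HolderConjugate.two_two) f g

theorem norm_conv_apply_le (f g : L2Omega ω) (π : Dual G) :
    traceNorm ((coeff f π)ᴴ * coeff g π) * π.dim * ω π ≤ ‖f π‖ * ‖g π‖ := by
  have h := ω.dim_mul_pos π
  calc _ = (π.dim * ω π) * traceNorm ((coeff f π)ᴴ * coeff g π) := by ring
    _ ≤ (π.dim * ω π) * (Real.sqrt (hsNormSq (coeff f π)) * Real.sqrt (hsNormSq (coeff g π))) := by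
        gcongr
        exact traceNorm_conjTranspose_mul_le _ _
    _ = (Real.sqrt (π.dim * ω π) * Real.sqrt (π.dim * ω π))
          * (Real.sqrt (hsNormSq (coeff f π)) * Real.sqrt (hsNormSq (coeff g π))) := by
        rw [Real.mul_self_sqrt h.le]
    _ = ‖f π‖ * ‖g π‖ := by
        rw [HSFiber.norm_eq, HSFiber.norm_eq]
        change _ = _ * Real.sqrt (hsNormSq (coeff f π)) * (_ * Real.sqrt (hsNormSq (coeff g π)))
        ring

/-- The element of `A_ω(G)` with Fourier coefficients `f̂(π)ᴴ ĝ(π)`. -/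
noncomputable def conv (f g : L2Omega ω) : BeurlingSpace ω :=
  ⟨fun π => (show TrFiber ω π from (coeff f π)ᴴ * coeff g π), by
    refine (memℓp_gen_iff (by simp)).2 ?_
    have h : Summable fun π => traceNorm ((coeff f π)ᴴ * coeff g π) * π.dim * ω π :=
      Summable.of_nonneg_of_le (fun π => (TrFiber.normCore ω π).norm_nonneg _)
        (norm_conv_apply_le f g) (summable_norm_mul_norm f g)
    refine h.congr fun π => ?_
    rw [ENNReal.toReal_one, Real.rpow_one]
    rfl⟩

/-- Cauchy-Schwarz twice: for Hilbert-Schmidt norms at each `π`, then for the sum over `π`. -/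
theorem norm_conv_le (f g : L2Omega ω) : ‖conv f g‖ ≤ ‖f‖ * ‖g‖ := by
  rw [BeurlingSpace.norm_eq_tsum]
  refine ((conv f g).summable_norm.tsum_le_tsum (norm_conv_apply_le f g)
    (summable_norm_mul_norm f g)).trans ?_
  exact lp.tsum_mul_le_mul_norm' (by simpa using Real.HolderConjugate.two_two) f g

theorem conv_add_left (f f' g : L2Omega ω) : conv (f + f') g = conv f g + conv f' g := by
  ext π : 2
  change (coeff f π + coeff f' π)ᴴ * coeff g π = (coeff f π)ᴴ * coeff g π + (coeff f' π)ᴴ * coeff g π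
  rw [Matrix.conjTranspose_add, Matrix.add_mul]

theorem conv_smul_left (c : ℂ) (f g : L2Omega ω) : conv (c • f) g = conj c • conv f g := by
  ext π : 2
  change (c • coeff f π)ᴴ * coeff g π = conj c • ((coeff f π)ᴴ * coeff g π)
  rw [Matrix.conjTranspose_smul, Matrix.smul_mul]
  rfl

theorem conv_add_right (f g g' : L2Omega ω) : conv f (g + g') = conv f g + conv f g' := by
  ext π : 2
  exact Matrix.mul_add (coeff f π)ᴴ (coeff g π) (coeff g' π)

theorem conv_smul_right (c : ℂ) (f g : L2Omega ω) : conv f (c • g) = c • conv f g := by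
  ext π : 2
  exact Matrix.mul_smul (coeff f π)ᴴ c (coeff g π)

/-- A bounded functional `T` on `A_ω(G)` gives a bounded operator on `L²_ω(G)`. -/
theorem exists_operator_scalarProd_eq (T : BeurlingSpace ω →L[ℂ] ℂ) :
    ∃ S : L2Omega ω →L[ℂ] L2Omega ω, ∀ f g, scalarProd (S f) g = conj (T (conv f g)) := by
  -- `conv` is conjugate-linear in `f` and linear in `g`, the opposite of `scalarProd (S f) g`; this
  -- is the source of the conjugate in the statement.
  let B : L2Omega ω →L⋆[ℂ] L2Omega ω →L[ℂ] ℂ :=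
    LinearMap.mkContinuous₂
      (LinearMap.mk₂'ₛₗ (starRingEnd ℂ) (RingHom.id ℂ) (fun f g => T (conv f g))
        (fun f f' g => by rw [conv_add_left, map_add])
        (fun c f g => by rw [conv_smul_left, map_smul])
        (fun f g g' => by rw [conv_add_right, map_add])
        (fun c f g => by rw [conv_smul_right, map_smul]; rfl))
      ‖T‖ fun f g => by
        rw [mul_assoc]
        exact T.le_opNorm_of_le (norm_conv_le f g)
  refine ⟨InnerProductSpace.continuousLinearMapOfBilin B, fun f g => ?_⟩
  have h := InnerProductSpace.continuousLinearMapOfBilin_apply B f g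
  rw [scalarProd, ← inner_conj_symm]
  exact congrArg conj h

end

variable [IsTopologicalGroup G] [CompactSpace G] [MeasurableSpace G] [BorelSpace G]

theorem norm_trigLp_sq (π : Dual G) (A : Matrix (Fin π.dim) (Fin π.dim) ℂ) :
    ‖trigLp π A‖ ^ 2 = π.dim * hsNormSq A := by
  have h := inner_trigLp_self π A A
  rw [trace_mul_conjTranspose_self, inner_self_eq_norm_sq_to_K] at h
  apply Complex.ofReal_injective
  rw [Complex.ofReal_mul, Complex.ofReal_natCast, ← h, Complex.ofReal_pow]
  rfl

theorem summable_trigLp {A : Series G} (hA : Summable fun π : Dual G => π.dim * hsNormSq (A π)) :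
    Summable fun π => trigLp π (A π) := by
  have hV : OrthogonalFamily ℂ (fun π : Dual G => LinearMap.range (trigLp π))
      fun π => (LinearMap.range (trigLp π)).subtypeₗᵢ := by
    rintro π σ h ⟨_, B, rfl⟩ ⟨_, C, rfl⟩
    exact inner_trigLp_of_ne h B C
  have h := (hV.summable_iff_norm_sq_summable fun π => ⟨trigLp π (A π), A π, rfl⟩).2 ?_
  · exact h
  · refine hA.congr fun π => ?_
    rw [← norm_trigLp_sq]
    rfl

theorem inner_tsum_trigLp {A B : Series G} (hA : Summable fun π => trigLp π (A π))
    (hB : Summable fun π => trigLp π (B π)) :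
    inner ℂ (∑' π, trigLp π (A π)) (∑' π, trigLp π (B π))
      = ∑' π : Dual G, (π.dim : ℂ) * (B π * (A π)ᴴ).trace := by
  have h1 : ∀ π, inner ℂ (trigLp π (A π)) (∑' σ, trigLp σ (B σ))
      = (π.dim : ℂ) * (B π * (A π)ᴴ).trace := by
    intro π
    have h := hB.hasSum.mapL (innerSL ℂ (trigLp π (A π)))
    rw [← inner_trigLp_self]
    refine h.unique (hasSum_single π fun σ hσ => ?_)
    exact inner_trigLp_of_ne hσ.symm _ _
  have h2 := hA.hasSum.mapL (innerSL ℂ (∑' σ, trigLp σ (B σ)))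
  have h3 := Complex.hasSum_conj'.2 h2
  simp only [innerSL_apply_apply, inner_conj_symm, h1] at h3
  exact h3.tsum_eq.symm

theorem leftRegular_trigLp (x : G) (π : Dual G) (A : Matrix (Fin π.dim) (Fin π.dim) ℂ) :
    leftRegular x⁻¹ (trigLp π A) = trigLp π (A * π.mat x) := by
  refine (leftRegular_toLp x⁻¹ (trigFun π A)).trans ?_
  change _ = ContinuousMap.toLp 2 (haarProb G) ℂ (trigFun π (A * π.mat x))
  congr 1
  ext t
  simp [trigFun_apply, π.mat_mul, Matrix.mul_assoc]

variable {ω : Weight G}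

theorem summable_trigLp_coeff (hω : ω.IsBounded) (ξ : L2Omega ω) :
    Summable fun π => trigLp π (coeff ξ π) := by
  obtain ⟨c, hc, hω⟩ := hω
  have h := (memℓp_gen_iff (p := 2) (by simp)).1 (lp.memℓp ξ)
  refine summable_trigLp (Summable.of_nonneg_of_le (fun π => ?_) (fun π => ?_) (h.mul_left c⁻¹))
  · exact mul_nonneg (Nat.cast_nonneg _) (hsNormSq_nonneg _)
  · have h1 : ‖ξ π‖ ^ (2 : ℝ≥0∞).toReal = π.dim * ω π * hsNormSq (coeff ξ π) := by
      rw [ENNReal.toReal_ofNat, Real.rpow_ofNat]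
      exact HSFiber.norm_sq (ξ π)
    have h0 := hsNormSq_nonneg (coeff ξ π)
    rw [h1, ← div_eq_inv_mul, le_div_iff₀ hc]
    calc (π.dim : ℝ) * hsNormSq (coeff ξ π) * c ≤ π.dim * hsNormSq (coeff ξ π) * ω π := by
          gcongr
          exact hω π
      _ = _ := by ring

theorem toL2_eq_tsum_trigLp (ξ : L2Omega ω) : toL2 ξ = ∑' π, trigLp π (coeff ξ π) := rfl

/-- The function with Fourier coefficients `f̂(π)ᴴ ĝ(π)` is `x ↦ ∫ conj (f(t)) g(xt) dt`. -/
theorem evalSeries_conv (hω : ω.IsBounded) (f g : L2Omega ω) (x : G) :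
    evalSeries (conv f g).toSeries x = inner ℂ (toL2 f) (leftRegular x⁻¹ (toL2 g)) := by
  have hf := summable_trigLp_coeff hω f
  have hg := summable_trigLp_coeff hω g
  have h := hg.hasSum.mapL (leftRegular x⁻¹).toContinuousLinearMap
  have htr : ∀ π, (leftRegular x⁻¹).toContinuousLinearMap (trigLp π (coeff g π))
      = trigLp π (coeff g π * π.mat x) := fun π => leftRegular_trigLp x π _
  simp_rw [htr] at h
  have h1 : leftRegular x⁻¹ (toL2 g) = ∑' π, trigLp π (coeff g π * π.mat x) := h.tsum_eq.symm
  have h2 := inner_tsum_trigLp (A := coeff f) (B := fun π => coeff g π * π.mat x) hf h.summable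
  rw [h1, toL2_eq_tsum_trigLp, h2]
  refine tsum_congr fun π => ?_
  have h3 : (conv f g).toSeries π = (coeff f π)ᴴ * coeff g π := rfl
  rw [h3, Matrix.mul_assoc, Matrix.trace_mul_comm]

theorem isClosed_essSupport (f : G → ℂ) : IsClosed (essSupport f) := by
  rw [← isOpen_compl_iff, isOpen_iff_mem_nhds]
  intro x hx
  simp only [essSupport, Set.mem_compl_iff, Set.mem_ofPred_eq, not_forall, not_not] at hx
  obtain ⟨U, hU, h⟩ := hx
  filter_upwards [eventually_mem_nhds_iff.2 hU] with y hy hc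
  exact hc U hy h

/-- `G` need not be second countable, so the complement of the support may have no countable cover
by sets on which `f` is null. Compact subsets have finite ones, and inner regularity of Haar measure
does the rest. -/
theorem ae_eq_zero_of_notMem_essSupport [T2Space G] (f : G → ℂ) :
    ∀ᵐ t ∂(haarProb G), t ∉ essSupport f → f t = 0 := by
  have hopen := (isClosed_essSupport f).isOpen_compl
  have hcomp : ∀ K : Set G, IsCompact K → K ⊆ (essSupport f)ᶜ →
      haarProb G (K ∩ {t | f t ≠ 0}) = 0 := by
    intro K hK hsub
    refine hK.induction_on (p := fun s => haarProb G (s ∩ {t | f t ≠ 0}) = 0) (by simp)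
      (fun s t hst ht => measure_mono_null (Set.inter_subset_inter_left _ hst) ht)
      (fun s t hs ht => by rw [Set.union_inter_distrib_right]; exact measure_union_null hs ht) ?_
    intro x hx
    have hx' := hsub hx
    simp only [essSupport, Set.mem_compl_iff, Set.mem_ofPred_eq, not_forall, not_not] at hx'
    obtain ⟨U, hU, h⟩ := hx'
    refine ⟨U, mem_nhdsWithin_of_mem_nhds hU, ?_⟩
    refine measure_mono_null ?_ (ae_iff.1 h)
    rintro t ⟨h1, h2⟩ h3
    exact h2 (h3 h1)
  rw [ae_iff, ← nonpos_iff_eq_zero]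
  refine le_of_forall_pos_le_add fun ε hε => ?_
  obtain ⟨K, hKsub, hK, hlt⟩ := hopen.measurableSet.exists_isCompact_sdiff_lt
    (measure_ne_top (haarProb G) _) hε.ne'
  calc haarProb G {t | ¬(t ∉ essSupport f → f t = 0)}
      ≤ haarProb G ((K ∩ {t | f t ≠ 0}) ∪ ((essSupport f)ᶜ \ K)) := by
        refine measure_mono fun t ht => ?_
        simp only [Set.mem_ofPred_eq, Classical.not_imp] at ht
        by_cases htK : t ∈ K
        · exact Or.inl ⟨htK, ht.2⟩
        · exact Or.inr ⟨ht.1, htK⟩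
    _ ≤ 0 + ε := by
        refine (measure_union_le _ _).trans ?_
        rw [hcomp K hK hKsub]
        gcongr

/-- The integrand `conj (f(t)) g(xt)` is nonzero only when `t` lies in the support of `f` and `xt`
in that of `g`, up to null sets, and then `x = (xt) t⁻¹`. -/
theorem evalSeries_conv_eq_zero [T2Space G] (hω : ω.IsBounded) (f g : L2Omega ω) {x : G}
    (hx : ∀ s ∈ essSupport (toL2 g), ∀ t ∈ essSupport (toL2 f), x ≠ s * t⁻¹) :
    evalSeries (conv f g).toSeries x = 0 := by
  rw [evalSeries_conv hω, L2.inner_def]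
  refine integral_eq_zero_of_ae ?_
  have hg := (measurePreserving_mul_left (haarProb G) x).quasiMeasurePreserving.ae
    (ae_eq_zero_of_notMem_essSupport (toL2 g))
  filter_upwards [ae_eq_zero_of_notMem_essSupport (toL2 f), hg, leftRegular_ae_eq x⁻¹ (toL2 g)]
    with t h1 h2 h3
  rw [h3, inv_inv]
  by_cases ht : t ∈ essSupport (toL2 f)
  · rw [h2 fun h => hx _ h _ ht (by simp)]
    simp
  · rw [h1 ht]
    simp

/-- The operator given by a functional that annihilates the functions vanishing near `E` is
supported in `E*`. -/
theorem opSupport_subset_starSet [T2Space G] (hω : ω.IsBounded) {E : Set G} (hE : IsClosed E)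
    {T : BeurlingSpace ω →L[ℂ] ℂ} (hT : ∀ v ∈ BeurlingSpace.vanishingNear hω E, T v = 0)
    {S : L2Omega ω →L[ℂ] L2Omega ω} (hS : ∀ f g, scalarProd (S f) g = conj (T (conv f g))) :
    opSupport S ⊆ starSet E := by
  rintro ⟨s, t⟩ hp
  by_contra hst
  have hcont : ContinuousAt (fun p : G × G => p.1 * p.2⁻¹) (s, t) := by fun_prop
  have hnhds := hcont.preimage_mem_nhds (hE.isOpen_compl.mem_nhds hst)
  obtain ⟨U, hU, V, hV, hUV⟩ := mem_nhds_prod_iff.1 hnhds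
  obtain ⟨f, g, hf, hg, hne⟩ := hp U hU V hV
  refine hne ?_
  rw [hS, hT, map_zero]
  -- `f` and `g` are supported in neighbourhoods whose quotients avoid `E`. The set `C` of quotients
  -- of the supports themselves is compact, so its complement is an open set containing `E` on which
  -- `conv f g` vanishes.
  set C : Set G := (fun p : G × G => p.1 * p.2⁻¹) '' (essSupport (toL2 g) ×ˢ essSupport (toL2 f))
  have hC : IsCompact C :=
    ((isClosed_essSupport _).isCompact.prod (isClosed_essSupport _).isCompact).image (by fun_prop)
  refine ⟨Cᶜ, hC.isClosed.isOpen_compl.mem_nhdsSet.2 ?_, fun x hx => ?_⟩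
  · rintro x hx ⟨p, hp, rfl⟩
    exact hUV (show p ∈ U ×ˢ V from ⟨hg hp.1, hf hp.2⟩) hx
  · refine evalSeries_conv_eq_zero hω f g fun a ha b hb h => hx ⟨(a, b), ⟨ha, hb⟩, h.symm⟩

end Convolution

/-! ### Rank one matrices supported in a single row -/

section RowUnit

open scoped ComplexConjugate Matrix.Norms.L2Operator

variable {d : ℕ}

/-- The matrix `e_k xᴴ`. -/
def rowUnit (k : Fin d) (x : EuclideanSpace ℂ (Fin d)) : Matrix (Fin d) (Fin d) ℂ :=
  Matrix.vecMulVec (Pi.single k 1) (star x.ofLp)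

theorem rowUnit_zero (k : Fin d) : rowUnit k 0 = 0 := by
  simp [rowUnit]

theorem hsNormSq_rowUnit (k : Fin d) (x : EuclideanSpace ℂ (Fin d)) :
    hsNormSq (rowUnit k x) = ‖x‖ ^ 2 := by
  rw [EuclideanSpace.norm_sq_eq, hsNormSq, Finset.sum_eq_single k]
  · simp [rowUnit, Matrix.vecMulVec_apply]
  · intro i _ hi
    simp [rowUnit, Matrix.vecMulVec_apply, hi]
  · simp

theorem conjTranspose_rowUnit_mul (k : Fin d) (x y : EuclideanSpace ℂ (Fin d)) :
    (rowUnit k x)ᴴ * rowUnit k y = Matrix.vecMulVec x.ofLp (star y.ofLp) := by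
  ext i j
  rw [Matrix.mul_apply, Finset.sum_eq_single k]
  · simp [rowUnit, Matrix.vecMulVec_apply]
  · intro i _ hi
    simp [rowUnit, Matrix.vecMulVec_apply, hi]
  · simp

theorem trace_rowUnit_mul (k : Fin d) (x : EuclideanSpace ℂ (Fin d))
    (M : Matrix (Fin d) (Fin d) ℂ) :
    (rowUnit k x * M).trace = conj (Matrix.toEuclideanLin Mᴴ x k) := by
  rw [Matrix.trace, Finset.sum_eq_single k]
  · simp [rowUnit, Matrix.mul_apply, Matrix.vecMulVec_apply, Matrix.toLpLin_apply, Matrix.mulVec,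
      dotProduct, mul_comm]
  · intro i _ hi
    simp [rowUnit, Matrix.mul_apply, Matrix.vecMulVec_apply, hi]
  · simp

/-- The sum over the rows `k` is an inner product expanded in coordinates. With `M = π(t)` and `N =
π(s)` the factor `N Mᴴ` becomes `π(s t⁻¹)`. -/
theorem sum_conj_trace_rowUnit_mul (x y : EuclideanSpace ℂ (Fin d))
    (M N : Matrix (Fin d) (Fin d) ℂ) :
    ∑ k, conj (rowUnit k x * M).trace * (rowUnit k y * N).trace
      = (Matrix.vecMulVec x.ofLp (star y.ofLp) * (N * Mᴴ)).trace := by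
  have h : Matrix.toEuclideanLin (N * Mᴴ) x = Matrix.toEuclideanLin N (Matrix.toEuclideanLin Mᴴ x) := by
    ext i
    simp [Matrix.toLpLin_apply]
  have hadj : ∀ v w, inner ℂ v (Matrix.toEuclideanLin N w)
      = inner ℂ (Matrix.toEuclideanLin Nᴴ v) w := by
    intro v w
    rw [Matrix.toEuclideanLin_conjTranspose_eq_adjoint, LinearMap.adjoint_inner_left]
  rw [trace_vecMulVec_star_mul, h, hadj, PiLp.inner_apply]
  refine Finset.sum_congr rfl fun k _ => ?_
  rw [trace_rowUnit_mul, trace_rowUnit_mul, Complex.conj_conj]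
  rfl

/-- Cauchy-Schwarz in `k`; bounding the terms one by one would cost a factor `d`. -/
theorem sum_norm_trace_rowUnit_mul_le (x y : EuclideanSpace ℂ (Fin d))
    {M N : Matrix (Fin d) (Fin d) ℂ} (hM : ‖M‖ ≤ 1) (hN : ‖N‖ ≤ 1) :
    ∑ k, ‖conj (rowUnit k x * M).trace * (rowUnit k y * N).trace‖ ≤ ‖x‖ * ‖y‖ := by
  have hle : ∀ (v : EuclideanSpace ℂ (Fin d)) {L : Matrix (Fin d) (Fin d) ℂ}, ‖L‖ ≤ 1 →
      ‖Matrix.toEuclideanLin Lᴴ v‖ ≤ ‖v‖ := by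
    intro v L hL
    refine (norm_toEuclideanLin_le _ v).trans ?_
    rw [Matrix.l2_opNorm_conjTranspose]
    exact mul_le_of_le_one_left (norm_nonneg _) hL
  calc _ = ∑ k, ‖Matrix.toEuclideanLin Mᴴ x k‖ * ‖Matrix.toEuclideanLin Nᴴ y k‖ := by
        refine Finset.sum_congr rfl fun k _ => ?_
        rw [trace_rowUnit_mul, trace_rowUnit_mul, Complex.conj_conj, norm_mul, RCLike.norm_conj]
    _ ≤ ‖Matrix.toEuclideanLin Mᴴ x‖ * ‖Matrix.toEuclideanLin Nᴴ y‖ := by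
        rw [EuclideanSpace.norm_eq, EuclideanSpace.norm_eq]
        exact Real.sum_mul_le_sqrt_mul_sqrt _ _ _
    _ ≤ _ := mul_le_mul (hle x hM) (hle y hN) (norm_nonneg _) (norm_nonneg _)

end RowUnit

/-! ### Operator synthesis implies spectral synthesis -/

section Synthesis

open scoped ComplexConjugate

variable {G : Type u} [Group G] [TopologicalSpace G]

open scoped Classical in
/-- The element of `L²_ω(G)` with the single Fourier coefficient `A` at `π`. -/
noncomputable def singleL2 (ω : Weight G) (π : Dual G) (A : Matrix (Fin π.dim) (Fin π.dim) ℂ) :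
    L2Omega ω := lp.single 2 π (show HSFiber ω π from A)

open scoped Classical in
/-- The element of `A_ω(G)` with the single Fourier coefficient `A` at `π`. -/
noncomputable def singleBeurling (ω : Weight G) (π : Dual G) :
    Matrix (Fin π.dim) (Fin π.dim) ℂ →ₗ[ℂ] BeurlingSpace ω :=
  lp.lsingle (𝕜 := ℂ) (E := fun π : Dual G => TrFiber ω π) 1 π

variable {ω : Weight G}

theorem coeff_singleL2_self (π : Dual G) (A : Matrix (Fin π.dim) (Fin π.dim) ℂ) :
    coeff (singleL2 ω π A) π = A := by
  classical
  exact lp.single_apply_self (E := fun π : Dual G => HSFiber ω π) 2 π A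

theorem coeff_singleL2_of_ne {π σ : Dual G} (h : σ ≠ π) (A : Matrix (Fin π.dim) (Fin π.dim) ℂ) :
    coeff (singleL2 ω π A) σ = 0 := by
  classical
  exact lp.single_apply_ne (E := fun π : Dual G => HSFiber ω π) 2 π A h

theorem norm_singleL2 (π : Dual G) (A : Matrix (Fin π.dim) (Fin π.dim) ℂ) :
    ‖singleL2 ω π A‖ = Real.sqrt (π.dim * ω π) * Real.sqrt (hsNormSq A) := by
  classical
  rw [singleL2, lp.norm_single (by simp), HSFiber.norm_eq]
  rfl

theorem toSeries_singleBeurling_self (π : Dual G) (A : Matrix (Fin π.dim) (Fin π.dim) ℂ) :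
    (singleBeurling ω π A).toSeries π = A := by
  classical
  exact lp.single_apply_self (E := fun π : Dual G => TrFiber ω π) 1 π A

theorem toSeries_singleBeurling_of_ne {π σ : Dual G} (h : σ ≠ π)
    (A : Matrix (Fin π.dim) (Fin π.dim) ℂ) : (singleBeurling ω π A).toSeries σ = 0 := by
  classical
  exact lp.single_apply_ne (E := fun π : Dual G => TrFiber ω π) 1 π A h

theorem evalSeries_singleBeurling (π : Dual G) (A : Matrix (Fin π.dim) (Fin π.dim) ℂ) (s : G) :
    evalSeries (singleBeurling ω π A).toSeries s = π.dim * (A * π.mat s).trace := by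
  rw [evalSeries, tsum_eq_single π, toSeries_singleBeurling_self]
  intro σ hσ
  rw [toSeries_singleBeurling_of_ne hσ, Matrix.zero_mul, Matrix.trace_zero, mul_zero]

theorem hasSum_singleBeurling (u : BeurlingSpace ω) :
    HasSum (fun π => singleBeurling ω π (u.toSeries π)) u := by
  classical
  exact lp.hasSum_single (E := fun π : Dual G => TrFiber ω π) (p := 1) (by simp) u

theorem conv_singleL2 (π : Dual G) (A B : Matrix (Fin π.dim) (Fin π.dim) ℂ) :
    conv (singleL2 ω π A) (singleL2 ω π B) = singleBeurling ω π (Aᴴ * B) := by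
  ext σ : 2
  change (coeff (singleL2 ω π A) σ)ᴴ * coeff (singleL2 ω π B) σ
    = (singleBeurling ω π (Aᴴ * B)).toSeries σ
  by_cases h : σ = π
  · subst h
    rw [coeff_singleL2_self, coeff_singleL2_self, toSeries_singleBeurling_self]
  · rw [coeff_singleL2_of_ne h, coeff_singleL2_of_ne h, toSeries_singleBeurling_of_ne h,
      Matrix.mul_zero]

variable [IsTopologicalGroup G] [CompactSpace G] [MeasurableSpace G] [BorelSpace G]

theorem toL2_singleL2_ae_eq (π : Dual G) (A : Matrix (Fin π.dim) (Fin π.dim) ℂ) :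
    toL2 (singleL2 ω π A) =ᵐ[haarProb G] trigFun π A := by
  have h : toL2 (singleL2 ω π A) = trigLp π A := by
    rw [toL2_eq_tsum_trigLp, tsum_eq_single π, coeff_singleL2_self]
    intro σ hσ
    rw [coeff_singleL2_of_ne hσ, map_zero]
  rw [h]
  exact ContinuousMap.coeFn_toLp (p := 2) (𝕜 := ℂ) (haarProb G) (trigFun π A)

theorem toL2_zero_ae_eq : toL2 (0 : L2Omega ω) =ᵐ[haarProb G] 0 := by
  have h : toL2 (0 : L2Omega ω) = 0 := by
    have h0 : ∀ π, coeff (0 : L2Omega ω) π = 0 := fun _ => rfl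
    rw [toL2_eq_tsum_trigLp]
    simp only [h0, map_zero, tsum_zero]
  rw [h]
  exact Lp.coeFn_zero ℂ 2 (haarProb G)

/-- A family with countably many nonzero terms can be summed as a sequence. -/
theorem hasSum_nat_of_hasSum {ι : Type*} {s : Set ι} {e : s → ℕ} (he : Function.Injective e)
    {Φ : ι → ℂ} {Ψ : ℕ → ℂ} {a : ℂ} (hΦ : ∀ i ∉ s, Φ i = 0) (hΨ : ∀ i : s, Ψ (e i) = Φ i)
    (hΨ0 : ∀ n ∉ Set.range e, Ψ n = 0) (h : HasSum Φ a) : HasSum Ψ a := by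
  rw [← he.hasSum_iff hΨ0]
  have h1 : Ψ ∘ e = Φ ∘ ((↑) : s → ι) := funext hΨ
  rw [h1, hasSum_subtype_iff_of_support_subset]
  · exact h
  · intro i hi
    by_contra hs
    exact hi (hΦ i hs)

/-- Every `u ∈ A_ω(G)` is a sum of convolutions `∑ conv fᵢ gᵢ` for which
`∑ conj fᵢ(t) gᵢ(s) = u(s t⁻¹)`. -/
theorem exists_sequences_of_beurlingSpace (hω : ω.IsBounded) (u : BeurlingSpace ω)
    (T : BeurlingSpace ω →L[ℂ] ℂ) :
    ∃ (f g : ℕ → L2Omega ω) (φ γ : ℕ → G → ℂ), Summable (fun n => ‖f n‖ * ‖g n‖) ∧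
      HasSum (fun n => T (conv (f n) (g n))) (T u) ∧
      (∀ n, toL2 (f n) =ᵐ[haarProb G] φ n) ∧ (∀ n, toL2 (g n) =ᵐ[haarProb G] γ n) ∧
      ∀ s t, HasSum (fun n => conj (φ n t) * γ n s) (evalSeries u.toSeries (s * t⁻¹)) := by
  choose x y hy _ hu hnorm using fun π => exists_singularValue_decomposition (u.toSeries π)
  -- Each pair `(e_k xᴴ, e_k zᴴ)` contributes the same coefficient `x zᴴ`, for `d_π` values of `k`;
  -- the factor `1 / d_π` compensates. All rows are needed for the pointwise identity, and the norms
  -- still add up to `‖u‖`.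
  set z : ∀ π : Dual G, Fin π.dim → EuclideanSpace ℂ (Fin π.dim) :=
    fun π j => ((π.dim : ℝ)⁻¹ : ℝ) • y π j with hz
  have hdpos : ∀ π : Dual G, (0 : ℝ) < π.dim := fun π => by exact_mod_cast π.dim_pos
  have hznorm : ∀ π j, ‖z π j‖ = (π.dim : ℝ)⁻¹ := fun π j => by
    rw [hz, norm_smul, (hy π).1 j, mul_one, Real.norm_of_nonneg (inv_nonneg.2 (hdpos π).le)]
  have hstarz : ∀ π j, star (z π j).ofLp = ((π.dim : ℂ)⁻¹) • star (y π j).ofLp := by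
    intro π j
    ext i
    simp [hz]
  let ι := Σ π : Dual G, Fin π.dim × Fin π.dim
  let A : ∀ i : ι, Matrix (Fin i.1.dim) (Fin i.1.dim) ℂ := fun i => rowUnit i.2.2 (x i.1 i.2.1)
  let B : ∀ i : ι, Matrix (Fin i.1.dim) (Fin i.1.dim) ℂ := fun i => rowUnit i.2.2 (z i.1 i.2.1)
  let f : ι → L2Omega ω := fun i => singleL2 ω i.1 (A i)
  let g : ι → L2Omega ω := fun i => singleL2 ω i.1 (B i)
  have hfg : ∀ i : ι, ‖f i‖ * ‖g i‖ = ω i.1 * ‖x i.1 i.2.1‖ := by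
    intro i
    have h := (ω.dim_mul_pos i.1).le
    simp only [f, g, A, B]
    rw [norm_singleL2, norm_singleL2, hsNormSq_rowUnit, hsNormSq_rowUnit,
      Real.sqrt_sq (norm_nonneg _), Real.sqrt_sq (norm_nonneg _), hznorm, mul_mul_mul_comm,
      Real.mul_self_sqrt h]
    field_simp [(hdpos i.1).ne']
  have hsum : Summable fun i : ι => ‖f i‖ * ‖g i‖ := by
    rw [summable_sigma_of_nonneg fun i => by positivity]
    refine ⟨fun π => Summable.of_finite, u.summable_norm.congr fun π => ?_⟩
    rw [tsum_fintype, Fintype.sum_prod_type]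
    have h : ‖u π‖ = ∑ j, ∑ _k : Fin π.dim, ω π * ‖x π j‖ := by
      simp only [Finset.sum_const, Finset.card_univ, Fintype.card_fin, nsmul_eq_mul]
      rw [← Finset.mul_sum, ← Finset.mul_sum, ← hnorm, TrFiber.norm_def]
      change traceNorm (u.toSeries π) * _ * _ = _
      ring
    simpa only [hfg] using h
  -- The dual object may be uncountable, but summability leaves only countably many nonzero terms,
  -- which can be listed as a sequence padded with zeros.
  set κ : Set ι := {i | x i.1 i.2.1 ≠ 0} with hκ
  have hκc : κ.Countable := by
    refine hsum.countable_support.mono fun i hi => ?_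
    rw [Function.mem_support, hfg]
    exact mul_ne_zero (ω.pos _).ne' (norm_ne_zero_iff.2 hi)
  have hA0 : ∀ i ∉ κ, A i = 0 := by
    intro i hi
    have hx : x i.1 i.2.1 = 0 := by simpa [hκ] using hi
    simp only [A, hx, rowUnit_zero]
  have hf0 : ∀ i ∉ κ, f i = 0 := by
    intro i hi
    rw [← norm_eq_zero]
    simp only [f]
    rw [norm_singleL2, hA0 i hi]
    simp [hsNormSq]
  have : Countable κ := hκc
  obtain ⟨e, he⟩ := exists_injective_nat κ
  refine ⟨Function.extend e (fun i => f i) 0, Function.extend e (fun i => g i) 0,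
    Function.extend e (fun i => trigFun i.1.1 (A i)) 0,
    Function.extend e (fun i => trigFun i.1.1 (B i)) 0, ?_, ?_, ?_, ?_, ?_⟩
  · rw [← he.summable_iff]
    · refine (hsum.comp_injective (Subtype.val_injective (p := (· ∈ κ)))).congr fun i => ?_
      simp only [Function.comp_apply, he.extend_apply]
    · intro n hn
      rw [Function.extend_apply' _ _ _ hn]
      simp
  · refine hasSum_nat_of_hasSum (Φ := fun i => T (conv (f i) (g i))) he (fun i hi => ?_)
      (fun i => ?_) (fun n hn => ?_) ?_
    · rw [hf0 i hi]
      have h := conv_smul_left (0 : ℂ) (0 : L2Omega ω) (g i)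
      rw [zero_smul, map_zero, zero_smul] at h
      rw [h, map_zero]
    · rw [he.extend_apply, he.extend_apply]
    · rw [Function.extend_apply' _ _ _ hn, Function.extend_apply' _ _ _ hn]
      have h := conv_smul_left (0 : ℂ) (0 : L2Omega ω) (0 : L2Omega ω)
      rw [zero_smul, map_zero, zero_smul] at h
      exact (congrArg T h).trans (map_zero T)
    · have h1 := (hasSum_singleBeurling u).mapL T
      refine HasSum.sigma_of_hasSum h1 (fun π => ?_) ?_
      · have h2 : T (singleBeurling ω π (u.toSeries π))
            = ∑ jk : Fin π.dim × Fin π.dim, T (conv (f ⟨π, jk⟩) (g ⟨π, jk⟩)) := by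
          simp only [f, g, conv_singleL2]
          rw [← map_sum, ← map_sum]
          congr 2
          simp only [A, B, conjTranspose_rowUnit_mul]
          rw [Fintype.sum_prod_type]
          conv_lhs => rw [hu π]
          refine Finset.sum_congr rfl fun j _ => ?_
          simp only [hstarz, Matrix.vecMulVec_smul, Finset.sum_const, Finset.card_univ,
            Fintype.card_fin]
          rw [← Nat.cast_smul_eq_nsmul ℂ, smul_smul, mul_inv_cancel₀ π.dim_ne_zero, one_smul]
        rw [h2]
        exact hasSum_fintype _
      · refine Summable.of_norm_bounded (hsum.mul_left ‖T‖) fun i => ?_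
        exact T.le_opNorm_of_le (norm_conv_le _ _)
  · intro n
    by_cases hn : n ∈ Set.range e
    · obtain ⟨i, rfl⟩ := hn
      rw [he.extend_apply, he.extend_apply]
      exact toL2_singleL2_ae_eq _ _
    · rw [Function.extend_apply' _ _ _ hn, Function.extend_apply' _ _ _ hn]
      exact toL2_zero_ae_eq
  · intro n
    by_cases hn : n ∈ Set.range e
    · obtain ⟨i, rfl⟩ := hn
      rw [he.extend_apply, he.extend_apply]
      exact toL2_singleL2_ae_eq _ _
    · rw [Function.extend_apply' _ _ _ hn, Function.extend_apply' _ _ _ hn]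
      exact toL2_zero_ae_eq
  · intro s t
    have hterm : ∀ i : ι, conj (trigFun i.1 (A i) t) * trigFun i.1 (B i) s
        = (i.1.dim : ℂ) ^ 2 * (conj (rowUnit i.2.2 (x i.1 i.2.1) * i.1.mat t).trace
            * (rowUnit i.2.2 (z i.1 i.2.1) * i.1.mat s).trace) := by
      intro i
      rw [trigFun_apply, trigFun_apply, map_mul, Complex.conj_natCast]
      ring
    refine hasSum_nat_of_hasSum
      (Φ := fun i => conj (trigFun i.1 (A i) t) * trigFun i.1 (B i) s) he (fun i hi => ?_)
      (fun i => ?_) (fun n hn => ?_) ?_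
    · rw [trigFun_apply, hA0 i hi]
      simp
    · rw [he.extend_apply, he.extend_apply]
    · rw [Function.extend_apply' _ _ _ hn, Function.extend_apply' _ _ _ hn]
      simp
    · refine HasSum.sigma_of_hasSum (BeurlingSpace.summable_eval hω u (s * t⁻¹)).hasSum
        (fun π => ?_) ?_
      · have h2 : (π.dim : ℂ) * (u.toSeries π * π.mat (s * t⁻¹)).trace
            = ∑ jk : Fin π.dim × Fin π.dim,
              conj (trigFun π (A ⟨π, jk⟩) t) * trigFun π (B ⟨π, jk⟩) s := by
          rw [Fintype.sum_prod_type]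
          simp only [hterm ⟨π, _⟩]
          conv_lhs => rw [hu π]
          rw [π.mat_mul, π.mat_inv, Finset.sum_mul, Matrix.trace_sum, Finset.mul_sum]
          refine Finset.sum_congr rfl fun j _ => ?_
          rw [← Finset.mul_sum, sum_conj_trace_rowUnit_mul, hstarz, Matrix.vecMulVec_smul,
            Matrix.smul_mul, Matrix.trace_smul, smul_eq_mul]
          field_simp [π.dim_ne_zero]
        rw [h2]
        exact hasSum_fintype _
      · obtain ⟨c, hc, hcω⟩ := hω
        have hunit : ∀ (π : Dual G) (r : G), Matrix.instL2OpNormedAddCommGroup.norm (π.mat r) ≤ 1 :=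
          fun π r => (norm_eq_one_of_mem_unitary_of_pos π.dim_pos (π.mat_mem_unitaryGroup r)).le
        refine Summable.of_norm ?_
        rw [summable_sigma_of_nonneg fun i => norm_nonneg _]
        refine ⟨fun π => Summable.of_finite, ?_⟩
        refine Summable.of_nonneg_of_le (fun π => tsum_nonneg fun _ => norm_nonneg _) (fun π => ?_)
          (u.summable_norm.mul_left c⁻¹)
        rw [tsum_fintype, Fintype.sum_prod_type]
        simp only [hterm ⟨π, _⟩]
        calc ∑ j, ∑ k, ‖(π.dim : ℂ) ^ 2 * (conj (rowUnit k (x π j) * π.mat t).trace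
            * (rowUnit k (z π j) * π.mat s).trace)‖
            ≤ ∑ j, (π.dim : ℝ) * ‖x π j‖ := by
              refine Finset.sum_le_sum fun j _ => ?_
              simp only [norm_mul ((π.dim : ℂ) ^ 2), norm_pow, Complex.norm_natCast]
              rw [← Finset.mul_sum]
              calc _ ≤ (π.dim : ℝ) ^ 2 * (‖x π j‖ * ‖z π j‖) := by
                    gcongr
                    exact sum_norm_trace_rowUnit_mul_le _ _ (hunit π t) (hunit π s)
                _ = _ := by
                    rw [hznorm]
                    field_simp [(hdpos π).ne']
          _ = π.dim * traceNorm (u.toSeries π) := by rw [← Finset.mul_sum, ← hnorm]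
          _ ≤ c⁻¹ * ‖u π‖ := by
              rw [TrFiber.norm_def, ← div_eq_inv_mul, le_div_iff₀ hc]
              change _ ≤ traceNorm (u.toSeries π) * _ * _
              have h0 := mul_nonneg (traceNorm_nonneg (u.toSeries π)) (hdpos π).le
              calc _ = traceNorm (u.toSeries π) * π.dim * c := by ring
                _ ≤ _ := mul_le_mul_of_nonneg_left (hcω π) h0

/-- The operator of a separating functional is tested against the kernel `conj (u(s t⁻¹))`, which
vanishes on `E*` when `u` vanishes on `E`. -/
theorem isSpectralSynthesis_of_isOperatorSynthesis [T2Space G] (hω : ω.IsBounded) {E : Set G}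
    (hE : IsClosed E) (hsyn : IsOperatorSynthesis ω (starSet E)) : IsSpectralSynthesis ω E := by
  refine (BeurlingSpace.idealJ_subset_idealI hω E).antisymm fun u hu => ?_
  obtain ⟨huA, hu0⟩ := hu
  obtain ⟨u, rfl⟩ := BeurlingSpace.exists_toSeries_eq huA
  rw [BeurlingSpace.toSeries_mem_idealJ_iff hω]
  by_contra hnot
  obtain ⟨T, hT, hTu⟩ := exists_dual_eq_zero_of_notMem_closure _ hnot
  obtain ⟨S, hS⟩ := exists_operator_scalarProd_eq T
  obtain ⟨f, g, φ, γ, hsum, hTsum, hφ, hγ, heval⟩ := exists_sequences_of_beurlingSpace hω u T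
  have h0 := hsyn S f g (opSupport_subset_starSet hω hE hT hS) hsum ?_
  · simp only [hS] at h0
    have h1 := (Complex.hasSum_conj'.2 hTsum).tsum_eq
    rw [h0] at h1
    exact hTu ((map_eq_zero _).1 h1.symm)
  -- The pointwise expansion holds for the continuous representatives; the `L²` classes agree with
  -- all of them at once off two null sets, one for each variable.
  · refine ⟨{s | ¬ ∀ n, toL2 (g n) s = γ n s}, {t | ¬ ∀ n, toL2 (f n) t = φ n t},
      ae_iff.1 (ae_all_iff.2 hγ), ae_iff.1 (ae_all_iff.2 hφ), ?_⟩
    rintro ⟨s, t⟩ ⟨hst, hns⟩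
    by_contra hc
    simp only [Set.mem_union, Set.mem_prod, Set.mem_univ, and_true, true_and, not_or,
      Set.mem_ofPred_eq, not_not] at hc
    refine hns ?_
    simp only [hc.1, hc.2]
    have h1 := heval s t
    rw [hu0 _ hst] at h1
    have h2 := Complex.hasSum_conj'.2 h1
    rw [map_zero] at h2
    simpa only [map_mul, Complex.conj_conj] using h2

end Synthesis

/-! ### Tensor products and the bound of `‖π(s) - 1‖` by word length -/

section TensorProduct

open scoped Matrix.Norms.L2Operator

variable {ι : Type*} [Fintype ι] {d : ι → ℕ}

/-- The tensor product of a finite family of matrices. -/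
def tensorOf (M : ∀ i, Matrix (Fin (d i)) (Fin (d i)) ℂ) :
    Matrix (∀ i, Fin (d i)) (∀ i, Fin (d i)) ℂ :=
  fun a b => ∏ i, M i (a i) (b i)

theorem tensorOf_one : tensorOf (fun i => (1 : Matrix (Fin (d i)) (Fin (d i)) ℂ)) = 1 := by
  ext a b
  simp only [tensorOf, Matrix.one_apply]
  rw [Finset.prod_ite_zero]
  simp [funext_iff]

variable [DecidableEq ι]

theorem tensorOf_mul (M N : ∀ i, Matrix (Fin (d i)) (Fin (d i)) ℂ) :
    tensorOf M * tensorOf N = tensorOf fun i => M i * N i := by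
  ext a b
  simp only [tensorOf, Matrix.mul_apply]
  rw [Finset.prod_univ_sum, Fintype.piFinset_univ]
  simp only [Finset.prod_mul_distrib]

/-- The matrix acting as `A` in the factor `i` and as the identity in the others. -/
def tensorAt (i : ι) (A : Matrix (Fin (d i)) (Fin (d i)) ℂ) :
    Matrix (∀ i, Fin (d i)) (∀ i, Fin (d i)) ℂ :=
  tensorOf (Function.update (fun j => (1 : Matrix (Fin (d j)) (Fin (d j)) ℂ)) i A)

theorem tensorAt_apply (i : ι) (A : Matrix (Fin (d i)) (Fin (d i)) ℂ) (a b : ∀ i, Fin (d i)) :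
    tensorAt i A a b = A (a i) (b i)
      * ∏ j ∈ Finset.univ.erase i, (1 : Matrix (Fin (d j)) (Fin (d j)) ℂ) (a j) (b j) := by
  rw [tensorAt, tensorOf, ← Finset.mul_prod_erase _ _ (Finset.mem_univ i), Function.update_self]
  congr 1
  refine Finset.prod_congr rfl fun j hj => ?_
  rw [Function.update_of_ne (Finset.ne_of_mem_erase hj)]

/-- `A ↦ 1 ⊗ ⋯ ⊗ A ⊗ ⋯ ⊗ 1` as a `⋆`-homomorphism. -/
def tensorAtHom (i : ι) : Matrix (Fin (d i)) (Fin (d i)) ℂ →⋆ₙₐ[ℂ]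
    Matrix (∀ i, Fin (d i)) (∀ i, Fin (d i)) ℂ where
  toFun := tensorAt i
  map_smul' c A := by
    ext a b
    simp [tensorAt_apply, mul_assoc]
  map_zero' := by
    ext a b
    simp [tensorAt_apply]
  map_add' A B := by
    ext a b
    simp [tensorAt_apply, add_mul]
  map_mul' A B := by
    rw [tensorAt, tensorAt, tensorAt, tensorOf_mul]
    congr 1
    funext j
    rcases eq_or_ne j i with rfl | h
    · simp
    · simp [Function.update_of_ne h]
  map_star' A := by
    ext a b
    rw [tensorAt_apply, Matrix.star_apply, Matrix.star_apply, tensorAt_apply, star_mul']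
    congr 1
    rw [star_prod]
    refine Finset.prod_congr rfl fun j _ => ?_
    rw [← Matrix.star_apply, star_one]

/-- A `⋆`-homomorphism between C⋆-algebras is contractive. -/
theorem norm_tensorAt_le (i : ι) (A : Matrix (Fin (d i)) (Fin (d i)) ℂ) : ‖tensorAt i A‖ ≤ ‖A‖ := by
  let _ : CStarAlgebra (Matrix (Fin (d i)) (Fin (d i)) ℂ) := { }
  let _ : CStarAlgebra (Matrix (∀ i, Fin (d i)) (∀ i, Fin (d i)) ℂ) := { }
  exact NonUnitalStarAlgHom.norm_apply_le (tensorAtHom i) A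

/-- Telescoping: inserting one factor at a time, `A X - 1 = (A - 1) + A (X - 1)` with `A` a
contraction. -/
theorem norm_tensorOf_sub_one_le (M : ∀ i, Matrix (Fin (d i)) (Fin (d i)) ℂ) (hM : ∀ i, ‖M i‖ ≤ 1) :
    ‖tensorOf M - 1‖ ≤ ∑ i, ‖M i - 1‖ := by
  have key : ∀ s : Finset ι,
      ‖tensorOf (fun i => if i ∈ s then M i else 1) - 1‖ ≤ ∑ i ∈ s, ‖M i - 1‖ := by
    intro s
    induction s using Finset.induction_on with
    | empty => simp [tensorOf_one]
    | insert i s hi ih =>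
      have hone : tensorAt i (1 : Matrix (Fin (d i)) (Fin (d i)) ℂ) = 1 := by
        rw [← tensorOf_one, tensorAt]
        congr 1
        exact Function.update_eq_self i _
      have hsub : tensorAt i (M i - 1) = tensorAt i (M i) - 1 := by
        rw [← hone]
        exact map_sub (tensorAtHom i) (M i) 1
      have hprod : tensorOf (fun j => if j ∈ insert i s then M j else 1)
          = tensorAt i (M i) * tensorOf (fun j => if j ∈ s then M j else 1) := by
        rw [tensorAt, tensorOf_mul]
        congr 1
        funext j
        rcases eq_or_ne j i with rfl | h
        · simp [hi]
        · simp [h]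
      rw [hprod, Finset.sum_insert hi]
      calc _ = ‖tensorAt i (M i - 1)
            + tensorAt i (M i) * (tensorOf (fun j => if j ∈ s then M j else 1) - 1)‖ := by
            rw [hsub, mul_sub, mul_one]
            congr 1
            abel
        _ ≤ ‖M i - 1‖ + 1 * ∑ j ∈ s, ‖M j - 1‖ := by
            refine norm_add_le_of_le (norm_tensorAt_le i _) ((norm_mul_le _ _).trans ?_)
            exact mul_le_mul ((norm_tensorAt_le i _).trans (hM i)) ih (norm_nonneg _) zero_le_one
        _ = _ := by rw [one_mul]
  simpa using key Finset.univ

variable {G : Type u} [Group G] [TopologicalSpace G]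

theorem Dual.norm_mat_le_one (π : Dual G) (s : G) : ‖π.mat s‖ ≤ 1 :=
  (norm_eq_one_of_mem_unitary_of_pos π.dim_pos (π.mat_mem_unitaryGroup s)).le

/-- `π(s) - 1` is the compression of `ρ(s) - 1` by the isometry `V`. -/
theorem Dual.IsSubrep.norm_mat_sub_one_le {κ : Type*} [Fintype κ] [DecidableEq κ] {π : Dual G}
    {ρ : G → Matrix κ κ ℂ} (h : π.IsSubrep ρ) (s : G) : ‖π.mat s - 1‖ ≤ ‖ρ s - 1‖ := by
  obtain ⟨V, hV, hVρ⟩ := h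
  have hV1 : ‖V‖ ≤ 1 := by
    have h1 := Matrix.l2_opNorm_conjTranspose_mul_self V
    have : Nonempty (Fin π.dim) := ⟨⟨0, π.dim_pos⟩⟩
    rw [hV, CStarRing.norm_one] at h1
    nlinarith [norm_nonneg V]
  have heq : π.mat s - 1 = Vᴴ * ((ρ s - 1) * V) := by
    rw [Matrix.sub_mul, hVρ, Matrix.mul_sub, ← Matrix.mul_assoc, hV, Matrix.one_mul,
      Matrix.one_mul, hV]
  rw [heq]
  calc _ ≤ ‖Vᴴ‖ * (‖ρ s - 1‖ * ‖V‖) :=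
        (Matrix.l2_opNorm_mul _ _).trans (by gcongr; exact Matrix.l2_opNorm_mul _ _)
    _ ≤ 1 * (‖ρ s - 1‖ * 1) := by
        rw [Matrix.l2_opNorm_conjTranspose]
        gcongr
    _ = _ := by rw [one_mul, mul_one]

/-- A word of length `τ_S(π)` has that many factors, each contributing at most the sum over `S`.
This ties the metric behaviour of `π` at `1` to the growth of the weight. -/
theorem norm_mat_sub_one_le_wordLength_mul {S : Set (Dual G)} (hS : S.Finite) (hgen : Generates S)
    (π : Dual G) (s : G) :
    ‖π.mat s - 1‖ ≤ wordLength S π * ∑ σ ∈ hS.toFinset, ‖σ.mat s - 1‖ := by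
  obtain ⟨σ, hσ, hsub⟩ : π ∈ tensorPower S (wordLength S π) := Nat.sInf_mem (hgen π)
  calc _ ≤ ‖tensorMat σ s - 1‖ := hsub.norm_mat_sub_one_le s
    _ ≤ ∑ i, ‖(σ i).mat s - 1‖ :=
        norm_tensorOf_sub_one_le (fun i => (σ i).mat s) fun i => (σ i).norm_mat_le_one s
    _ ≤ ∑ _i : Fin (wordLength S π), ∑ σ ∈ hS.toFinset, ‖σ.mat s - 1‖ := by
        refine Finset.sum_le_sum fun i _ => ?_
        exact Finset.single_le_sum (f := fun σ : Dual G => ‖σ.mat s - 1‖)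
          (fun _ _ => norm_nonneg _) (hS.mem_toFinset.2 (hσ i))
    _ = _ := by simp

end TensorProduct

theorem starSet_singleton_one {G : Type*} [Group G] : starSet ({1} : Set G) = Set.diagonal G := by
  ext ⟨s, t⟩
  simp [starSet, mul_inv_eq_one]

/-! ### Failure of spectral synthesis for `{1}` -/

section Diagonal

open scoped Matrix.Norms.L2Operator

variable {G : Type u} [Group G] [TopologicalSpace G]

theorem UnitaryIrrep.Equivalent.mat_eq_one {π σ : UnitaryIrrep G} (h : π.Equivalent σ) {s : G}
    (hσ : σ.mat s = 1) : π.mat s = 1 := by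
  obtain ⟨U, h1, -, h3⟩ := h
  calc π.mat s = π.mat s * U * Uᴴ := by rw [Matrix.mul_assoc, h1, Matrix.mul_one]
    _ = 1 := by rw [h3, hσ, Matrix.mul_one, h1]

variable (G) in
/-- The trivial representation. -/
def UnitaryIrrep.trivial : UnitaryIrrep G where
  dim := 1
  dim_pos := one_pos
  toHom := 1
  continuous_toHom := continuous_const
  irreducible W _ := by
    have : IsSimpleModule ℂ (Fin 1 → ℂ) := isSimpleModule_iff_finrank_eq_one.2 (by simp)
    exact eq_bot_or_eq_top W

theorem exists_dual_mat_eq_one : ∃ τ : Dual G, ∀ s, τ.mat s = 1 :=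
  ⟨⟦UnitaryIrrep.trivial G⟧, fun _ =>
    UnitaryIrrep.Equivalent.mat_eq_one (Quotient.mk_out (UnitaryIrrep.trivial G)) rfl⟩

theorem eq_one_of_forall_dual_mat_eq_one [IsTopologicalGroup G] [CompactSpace G] [T2Space G]
    [MeasurableSpace G] [BorelSpace G] {g : G} (h : ∀ π : Dual G, π.mat g = 1) : g = 1 := by
  by_contra hg
  obtain ⟨π, hπ⟩ := exists_unitaryIrrep_mat_ne_one hg
  exact hπ (UnitaryIrrep.Equivalent.mat_eq_one
    (UnitaryIrrep.setoid G |>.symm (Quotient.mk_out π)) (h ⟦π⟧))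

variable {ω : Weight G}

/-- The matrix coefficient `s ↦ σ(s)_{ij} - δ_{ij}`, as an element of `A_ω(G)`. -/
theorem exists_beurlingSpace_eval_eq (hω : ω.IsBounded) (σ : Dual G) (i j : Fin σ.dim) :
    ∃ u : BeurlingSpace ω, ∀ s, evalSeries u.toSeries s = (σ.mat s - 1) i j := by
  obtain ⟨τ, hτ⟩ := exists_dual_mat_eq_one (G := G)
  have hσ0 := σ.dim_ne_zero
  have hτ0 := τ.dim_ne_zero
  -- The scalar `d_σ⁻¹` cancels the dimension in the series. In the constant term one factor `d_τ`
  -- comes from the series and one from the trace of `1`, so `d_τ = 1` is not needed.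
  refine ⟨singleBeurling ω σ (Matrix.single j i (σ.dim : ℂ)⁻¹)
    - singleBeurling ω τ ((((τ.dim : ℂ) * τ.dim)⁻¹ * (1 : Matrix (Fin σ.dim) (Fin σ.dim) ℂ) i j) • 1),
    fun s => ?_⟩
  rw [BeurlingSpace.evalSeries_sub hω, evalSeries_singleBeurling, evalSeries_singleBeurling, hτ,
    Matrix.trace_single_mul, Matrix.mul_one, Matrix.trace_smul, Matrix.trace_one, Fintype.card_fin,
    Matrix.sub_apply]
  simp only [smul_eq_mul]
  field_simp

/-- Only some constant depending on `d` alone is needed; expansion in matrix units provides one. -/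
theorem norm_le_sum_norm_apply {d : ℕ} (M : Matrix (Fin d) (Fin d) ℂ) {c : ℝ}
    (hM : ∀ i j, ‖M i j‖ ≤ c) :
    ‖M‖ ≤ c * ∑ i : Fin d, ∑ j : Fin d, ‖Matrix.single i j (1 : ℂ)‖ := by
  conv_lhs => rw [Matrix.matrix_eq_sum_single M]
  rw [Finset.mul_sum]
  refine norm_sum_le_of_le _ fun i _ => ?_
  rw [Finset.mul_sum]
  refine norm_sum_le_of_le _ fun j _ => ?_
  have h : Matrix.single i j (M i j) = M i j • Matrix.single i j (1 : ℂ) := by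
    rw [Matrix.smul_single, smul_eq_mul, mul_one]
  rw [h, norm_smul]
  exact mul_le_mul_of_nonneg_right (hM i j) (norm_nonneg _)

/-- If `{1}` were a set of synthesis, every matrix coefficient would be `o(∑ ‖σ(g) - 1‖)` at `1`. -/
theorem eventually_norm_mat_sub_one_apply_le {S : Set (Dual G)} (hS : S.Finite)
    (hgen : Generates S) {C : ℝ} (hC : 0 < C) (hω : ω.IsBounded)
    (hωS : ∀ π, C * wordLength S π ≤ ω π) (hsyn : IsSpectralSynthesis ω ({1} : Set G))
    (σ : Dual G) (i j : Fin σ.dim) {η : ℝ} (hη : 0 < η) :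
    ∀ᶠ g in 𝓝 (1 : G), ‖(σ.mat g - 1) i j‖ ≤ C⁻¹ * (∑ σ ∈ hS.toFinset, ‖σ.mat g - 1‖) * η := by
  obtain ⟨u, hu⟩ := exists_beurlingSpace_eval_eq hω σ i j
  have hu1 : evalSeries u.toSeries 1 = 0 := by
    rw [hu, σ.mat_one, sub_self, Matrix.zero_apply]
  have hJ : u.toSeries ∈ idealJ ω ({1} : Set G) := by
    rw [hsyn]
    refine ⟨u.toSeries_mem, fun s hs => ?_⟩
    rw [Set.mem_singleton_iff.1 hs, hu1]
  rw [BeurlingSpace.toSeries_mem_idealJ_iff hω] at hJ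
  obtain ⟨v, ⟨U, hU, hv⟩, huv⟩ := Metric.mem_closure_iff.1 hJ η hη
  rw [nhdsSet_singleton] at hU
  filter_upwards [hU] with g hg
  -- Subtracting the value at `1` replaces `π(g)` by `π(g) - 1`, for which the word length bound is
  -- available. The difference itself is `(σ(g) - 1)_ij`, since `v` vanishes at `g` and at `1`.
  have hdiff : evalSeries (u - v).toSeries g - evalSeries (u - v).toSeries 1
      = ∑' π : Dual G, (π.dim : ℂ) * ((u - v).toSeries π * (π.mat g - 1)).trace := by
    rw [evalSeries, evalSeries, ← (BeurlingSpace.summable_eval hω (u - v) g).tsum_sub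
      (BeurlingSpace.summable_eval hω (u - v) 1)]
    refine tsum_congr fun π => ?_
    rw [π.mat_one, Matrix.mul_sub, Matrix.trace_sub, mul_sub]
  have hval : evalSeries (u - v).toSeries g - evalSeries (u - v).toSeries 1
      = (σ.mat g - 1) i j := by
    rw [BeurlingSpace.evalSeries_sub hω, BeurlingSpace.evalSeries_sub hω, hv g hg,
      hv 1 (mem_of_mem_nhds hU), hu1, hu, sub_zero, sub_zero, sub_zero]
  set ε := ∑ σ ∈ hS.toFinset, ‖σ.mat g - 1‖ with hε
  have hε0 : 0 ≤ ε := Finset.sum_nonneg fun _ _ => norm_nonneg _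
  have hle : ∀ π : Dual G, ‖π.mat g - 1‖ ≤ C⁻¹ * ε * ω π := by
    intro π
    refine (norm_mat_sub_one_le_wordLength_mul hS hgen π g).trans ?_
    calc (wordLength S π : ℝ) * ε = C⁻¹ * ε * (C * wordLength S π) := by field_simp
      _ ≤ C⁻¹ * ε * ω π := by
          gcongr
          exact hωS π
  rw [← hval, hdiff]
  refine ((u - v).norm_tsum_trace_mul_le hle).trans ?_
  gcongr
  rw [← dist_eq_norm]
  exact huv.le

/-- If `{1}` is a set of spectral synthesis for a weight growing at least linearly, then `{1}` is
open. -/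
theorem eventually_eq_one_of_isSpectralSynthesis [IsTopologicalGroup G] [CompactSpace G] [T2Space G]
    [MeasurableSpace G] [BorelSpace G] {S : Set (Dual G)} (hS : S.Finite)
    (hgen : Generates S) {C : ℝ} (hC : 0 < C) (hω : ω.IsBounded)
    (hωS : ∀ π, C * wordLength S π ≤ ω π) (hsyn : IsSpectralSynthesis ω ({1} : Set G)) :
    ∀ᶠ g in 𝓝 (1 : G), g = 1 := by
  set κ : Dual G → ℝ := fun σ => ∑ i : Fin σ.dim, ∑ j : Fin σ.dim, ‖Matrix.single i j (1 : ℂ)‖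
  set K : ℝ := ∑ σ ∈ hS.toFinset, κ σ with hK
  have hκ0 : ∀ σ, 0 ≤ κ σ := fun σ =>
    Finset.sum_nonneg fun _ _ => Finset.sum_nonneg fun _ _ => norm_nonneg _
  have hK0 : 0 ≤ K := Finset.sum_nonneg fun σ _ => hκ0 σ
  -- With this `η` the entrywise bounds sum to `ε ≤ ε K / (K + 1)`, which forces `ε = 0`.
  have hη : 0 < C * (K + 1)⁻¹ := by positivity
  have hev : ∀ᶠ g in 𝓝 (1 : G), ∀ σ ∈ hS.toFinset, ∀ i j,
      ‖(σ.mat g - 1) i j‖ ≤ C⁻¹ * (∑ σ ∈ hS.toFinset, ‖σ.mat g - 1‖) * (C * (K + 1)⁻¹) := by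
    rw [Filter.eventually_all_finset]
    intro σ _
    rw [Filter.eventually_all]
    intro i
    rw [Filter.eventually_all]
    intro j
    exact eventually_norm_mat_sub_one_apply_le hS hgen hC hω hωS hsyn σ i j hη
  filter_upwards [hev] with g hg
  set ε := ∑ σ ∈ hS.toFinset, ‖σ.mat g - 1‖ with hε
  have hε0 : 0 ≤ ε := Finset.sum_nonneg fun _ _ => norm_nonneg _
  have hle : ε ≤ ε * (K + 1)⁻¹ * K := by
    rw [hK, Finset.mul_sum]
    refine Finset.sum_le_sum fun σ hσ => ?_
    have h := norm_le_sum_norm_apply (σ.mat g - 1) (hg σ hσ)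
    calc _ ≤ _ := h
      _ = ε * (K + 1)⁻¹ * κ σ := by
          simp only [κ]
          field_simp
  have hεz : ε = 0 := by
    by_contra hne
    have hpos : 0 < ε := lt_of_le_of_ne hε0 (Ne.symm hne)
    have : ε * (K + 1)⁻¹ * K < ε := by
      rw [mul_assoc]
      refine mul_lt_of_lt_one_right hpos ?_
      rw [← div_eq_inv_mul, div_lt_one (by positivity)]
      exact lt_add_one K
    exact absurd hle this.not_ge
  refine eq_one_of_forall_dual_mat_eq_one fun π => ?_
  have h := norm_mat_sub_one_le_wordLength_mul hS hgen π g
  rw [← hε, hεz, mul_zero, norm_le_zero_iff, sub_eq_zero] at h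
  exact h

/-- Points of a manifold of positive dimension are not isolated. -/
theorem not_eventually_eq_of_chartedSpace {X : Type*} [TopologicalSpace X] {n : ℕ} (hn : 0 < n)
    [ChartedSpace (EuclideanSpace ℝ (Fin n)) X] (x : X) : ¬ ∀ᶠ y in 𝓝 x, y = x := by
  intro h
  have hopen : IsOpen ({x} : Set X) := isOpen_singleton_iff_nhds_eq_pure x |>.2
    (le_antisymm (Filter.le_pure_iff.2 h) (pure_le_nhds x))
  have himg := (chartAt (EuclideanSpace ℝ (Fin n)) x).isOpen_image_of_subset_source hopen
    (Set.singleton_subset_iff.2 (mem_chart_source _ x))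
  rw [Set.image_singleton] at himg
  have : Nonempty (Fin n) := ⟨⟨0, hn⟩⟩
  have : Nontrivial (EuclideanSpace ℝ (Fin n)) := inferInstance
  have := Module.punctured_nhds_neBot ℝ (EuclideanSpace ℝ (Fin n))
    (chartAt (EuclideanSpace ℝ (Fin n)) x x)
  exact not_isOpen_singleton _ himg

end Diagonal
end BeurlingFourier

theorem mainTheorem11 {G : Type*} [Group G] [TopologicalSpace G] [IsTopologicalGroup G]
    [CompactSpace G] [T2Space G] [MeasurableSpace G] [BorelSpace G] (ω : Weight G) :
    (ω.IsBounded → ∀ E : Set G, IsClosed E →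
      IsOperatorSynthesis ω (starSet E) → IsSpectralSynthesis ω E) ∧
    (∀ (n : ℕ) [ChartedSpace (EuclideanSpace ℝ (Fin n)) G] [LieGroup (𝓡 n) ((⊤ : ℕ∞) : WithTop ℕ∞) G], 0 < n →
      ∀ S : Set (Dual G), S.Finite → Generates S →
      ∀ C α : ℝ, 0 < C → 1 ≤ α →
        (∀ π, C * (1 + (wordLength S π : ℝ)) ^ α ≤ ω π) →
        ¬ IsOperatorSynthesis ω (Set.diagonal G)) := by
  refine ⟨fun hω E hE => isSpectralSynthesis_of_isOperatorSynthesis hω hE, ?_⟩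
  intro n _ _ hn S hS hgen C α hC hα hωS hsyn
  -- As `1 + τ_S ≥ 1`, an exponent `α ≥ 1` gives at least linear growth. The same bound gives `ω ≥
  -- C`, so `ω` is bounded and part (i) applies.
  have hle : ∀ π, C * (1 + (wordLength S π : ℝ)) ≤ ω π := fun π =>
    (mul_le_mul_of_nonneg_left (Real.self_le_rpow_of_one_le (by simp) hα) hC.le).trans (hωS π)
  have hω : ω.IsBounded := ⟨C, hC, fun π => le_trans (by
    nlinarith [Nat.cast_nonneg (α := ℝ) (wordLength S π)]) (hle π)⟩
  refine not_eventually_eq_of_chartedSpace hn (1 : G)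
    (eventually_eq_one_of_isSpectralSynthesis hS hgen hC hω (fun π => le_trans (by linarith) (hle π))
      (isSpectralSynthesis_of_isOperatorSynthesis hω isClosed_singleton ?_))
  rwa [starSet_singleton_one]
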